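/- Let $\Omega\subset\mathbb{R}^2$ be a simply connected polygon, i.e. the bounded domain enclosed by a simple closed polygonal curve, and let $\mathcal{T}$ be a finite partition of $\Omega$ into nondegenerate triangles such that the nonempty intersection of any two distinct (closed) elements is either a single common vertex or a single common edge of both. A \emph{noncorner vertex} is an element vertex that is not a vertex of the polygon $\Omega$. Let $\mathcal{V}_K$ denote the set of vertices of $K\in\mathcal{T}$, let $k\ge 1$ be an integer, let $\mathcal{P}_m(K)$ be the polynomials of total degree at most $m$ on $K$, and let $L^2_0(\Omega)=\{q\in L^2(\Omega):\int_\Omega q\,dx=0\}$. A piecewise polynomial is called $C^m$ at a vertex if its polynomial pieces on the elements containing that vertex have the same partial derivatives of order at most $m$ there. Write $(\cdot,\cdot)$ for the $L^2(\Omega)$ inner product, $a(\mathbf{u},\mathbf{v})=(\nabla\mathbf{u},\nabla\mathbf{v})$, and $\mathbf{curl}\,\phi=(\partial_y\phi,-\partial_x\phi)$. Define the global spaces \begin{align*} \Sigma_0&=\{\phi\in H^2_0(\Omega):\phi|_K\in\mathcal{P}_{k+1}(K)\ \forall K\in\mathcal{T},\ \phi\text{ is }C^2\text{ at noncorner vertices}\},\\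 V_0&=\{v\in H^1_0(\Omega):v|_K\in\mathcal{P}_{k}(K)\ \forall K\in\mathcal{T},\ v\text{ is }C^1\text{ at noncorner vertices}\},\qquad \mathbf{V}_0=V_0\times V_0,\\ Q_0&=\{q\in L^2_0(\Omega):q|_K\in\mathcal{P}_{k-1}(K)\ \forall K\in\mathcal{T},\ q\text{ is }C^0\text{ at noncorner vertices}\}, \end{align*} the interior spaces \begin{align*} \Sigma_I&=\{\phi\in\Sigma_0:\phi|_{\partial K}=\partial_n\phi|_{\partial K}=0\ \forall K\in\mathcal{T}\},\\ \mathbf{V}_I&=\{\mathbf{v}\in\mathbf{V}_0:\mathbf{v}|_{\partial K}=\mathbf{0}\ \forall K\in\mathcal{T}\},\\ Q_I&=\Big\{q\in Q_0:\int_K q\,dx=0,\ q|_K(\mathbf{a})=0\ \forall\mathbf{a}\in\mathcal{V}_K,\ \forall K\in\mathcal{T}\Big\}, \end{align*} where the values and normal derivatives on $\partial K$ are those of the polynomial piece on $K$, and the exterior spaces \begin{align*} \tilde\Sigma_E&=\{\phi\in\Sigma_0:a(\mathbf{curl}\,\phi,\mathbf{curl}\,\psi)=0\ \forall\psi\in\Sigma_I\},\\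 \tilde{Q}_E&=\{q\in Q_0:(q,r)=0\ \forall r\in Q_I\},\\ \tilde{\mathbf{V}}_E&=\{\mathbf{v}\in\mathbf{V}_0:\operatorname{div}\mathbf{v}\in\tilde{Q}_E,\ a(\mathbf{v},\mathbf{curl}\,\psi)=0\ \forall\psi\in\Sigma_I\}. \end{align*} Then the following (internal) direct sum decompositions hold: $$\Sigma_0=\Sigma_I\oplus\tilde\Sigma_E,\qquad \mathbf{V}_0=\mathbf{V}_I\oplus\tilde{\mathbf{V}}_E,\qquad Q_0=Q_I\oplus\tilde{Q}_E.$$ -/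

import Mathlib

open MeasureTheory TopologicalSpace
open scoped ContDiff

noncomputable section

namespace StokesFE

/-- Points of the Euclidean plane. -/
abbrev Pt := EuclideanSpace ℝ (Fin 2)

/-- The Hilbert space `L²(Ω)` of real functions; `inner ℝ u v` is `∫_Ω u v`. -/
abbrev L2 (Ω : Opens Pt) := Lp ℝ 2 (volume.restrict (Ω : Set Pt))

/-! ### Sobolev spaces -/

/-- Classical partial derivative. -/
def cpartial (i : Fin 2) (φ : Pt → ℝ) (x : Pt) : ℝ :=
  fderiv ℝ φ x (EuclideanSpace.single i 1)

/-- Test functions: `φ ∈ C_c^∞(Ω)`. -/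
structure IsTest (Ω : Opens Pt) (φ : Pt → ℝ) : Prop where
  smooth : ContDiff ℝ ∞ φ
  compact : HasCompactSupport φ
  support : tsupport φ ⊆ Ω

/-- `w` is the weak partial derivative `∂_i v` in `Ω`. -/
def HasWeakPartial (Ω : Opens Pt) (i : Fin 2) (v w : L2 Ω) : Prop :=
  ∀ φ : Pt → ℝ, IsTest Ω φ →
    ∫ x in (Ω : Set Pt), v x * cpartial i φ x = -∫ x in (Ω : Set Pt), w x * φ x

theorem IsTest.add {Ω : Opens Pt} {φ ψ : Pt → ℝ} (hφ : IsTest Ω φ) (hψ : IsTest Ω ψ) :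
    IsTest Ω (φ + ψ) :=
  ⟨hφ.smooth.add hψ.smooth, hφ.compact.add hψ.compact,
    (tsupport_add φ ψ).trans (Set.union_subset hφ.support hψ.support)⟩

theorem IsTest.smul {Ω : Opens Pt} {φ : Pt → ℝ} (c : ℝ) (hφ : IsTest Ω φ) :
    IsTest Ω (c • φ) :=
  ⟨contDiff_const.smul hφ.smooth, hφ.compact.smul_left,
    (tsupport_smul_subset_right (fun _ => c) φ).trans hφ.support⟩

theorem isTest_zero (Ω : Opens Pt) : IsTest Ω 0 :=
  ⟨contDiff_const, HasCompactSupport.zero, by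
    have : tsupport (0 : Pt → ℝ) = ∅ := by simp [tsupport]
    simp [this]⟩

theorem contDiff_cpartial {φ : Pt → ℝ} (i : Fin 2) (hφ : ContDiff ℝ ∞ φ) :
    ContDiff ℝ ∞ (cpartial i φ) :=
  (hφ.fderiv_right (m := ∞) (by simp)).clm_apply contDiff_const

theorem cpartial_add {φ ψ : Pt → ℝ} (i : Fin 2) (hφ : ContDiff ℝ ∞ φ) (hψ : ContDiff ℝ ∞ ψ) :
    cpartial i (φ + ψ) = cpartial i φ + cpartial i ψ := by
  funext x
  have h1 := (hφ.differentiable (by simp)).differentiableAt (x := x)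
  have h2 := (hψ.differentiable (by simp)).differentiableAt (x := x)
  simp [cpartial, fderiv_add h1 h2]

theorem cpartial_smul {φ : Pt → ℝ} (i : Fin 2) (c : ℝ) (hφ : ContDiff ℝ ∞ φ) :
    cpartial i (c • φ) = c • cpartial i φ := by
  funext x
  have h1 := (hφ.differentiable (by simp)).differentiableAt (x := x)
  simp [cpartial, fderiv_const_smul h1 c]

theorem cpartial_zero (i : Fin 2) : cpartial i 0 = 0 := by
  funext x
  simp [cpartial]

theorem hasCompactSupport_cpartial {φ : Pt → ℝ} (i : Fin 2) (hφ : HasCompactSupport φ) :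
    HasCompactSupport (cpartial i φ) :=
  (hφ.fderiv ℝ).comp_left (g := fun L : Pt →L[ℝ] ℝ => L (EuclideanSpace.single i 1)) rfl

theorem integrable_mul (Ω : Opens Pt) (v : L2 Ω) {φ : Pt → ℝ} (h1 : Continuous φ)
    (h2 : HasCompactSupport φ) :
    Integrable (fun x => v x * φ x) (volume.restrict (Ω : Set Pt)) := by
  have := (Lp.memLp v).integrable_mul (h1.memLp_of_hasCompactSupport h2 (p := 2)
    (μ := volume.restrict (Ω : Set Pt)))
  exact this

theorem HasWeakPartial.unique {Ω : Opens Pt} {i : Fin 2} {v w w' : L2 Ω}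
    (h : HasWeakPartial Ω i v w) (h' : HasWeakPartial Ω i v w') : w = w' := by
  have hloc : LocallyIntegrableOn (fun x => w x - w' x) (Ω : Set Pt)
      (volume.restrict (Ω : Set Pt)) := by
    have := (((Lp.memLp w).sub (Lp.memLp w')).locallyIntegrable (by norm_num))
    exact this.locallyIntegrableOn _
  have key := Ω.isOpen.ae_eq_zero_of_integral_contDiff_smul_eq_zero hloc (by
    intro g g1 g2 g3
    have e := (h g ⟨g1, g2, g3⟩).symm.trans (h' g ⟨g1, g2, g3⟩)
    have e2 := neg_injective e
    have i1 := integrable_mul Ω w g1.continuous g2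
    have i2 := integrable_mul Ω w' g1.continuous g2
    calc ∫ x in (Ω : Set Pt), g x • (w x - w' x)
        = ∫ x in (Ω : Set Pt), (w x * g x - w' x * g x) := by
          congr 1; funext x; simp only [smul_eq_mul]; ring
      _ = 0 := by rw [integral_sub i1 i2, e2, sub_self])
  apply Lp.ext
  filter_upwards [key, ae_restrict_mem Ω.isOpen.measurableSet] with x hx hm
  exact sub_eq_zero.mp (hx hm)

theorem HasWeakPartial.add {Ω : Opens Pt} {i : Fin 2} {v w v' w' : L2 Ω}
    (h : HasWeakPartial Ω i v w) (h' : HasWeakPartial Ω i v' w') :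
    HasWeakPartial Ω i (v + v') (w + w') := by
  intro φ hφ
  have c1 := (contDiff_cpartial i hφ.smooth).continuous
  have c2 := hasCompactSupport_cpartial i hφ.compact
  have e1 : ∫ x in (Ω : Set Pt), (v + v') x * cpartial i φ x =
      ∫ x in (Ω : Set Pt), (v x * cpartial i φ x + v' x * cpartial i φ x) := by
    apply integral_congr_ae
    filter_upwards [Lp.coeFn_add v v'] with x hx
    rw [hx, Pi.add_apply, add_mul]
  have e2 : ∫ x in (Ω : Set Pt), (w + w') x * φ x =
      ∫ x in (Ω : Set Pt), (w x * φ x + w' x * φ x) := by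
    apply integral_congr_ae
    filter_upwards [Lp.coeFn_add w w'] with x hx
    rw [hx, Pi.add_apply, add_mul]
  rw [e1, e2, integral_add (integrable_mul Ω v c1 c2) (integrable_mul Ω v' c1 c2),
    integral_add (integrable_mul Ω w hφ.smooth.continuous hφ.compact)
      (integrable_mul Ω w' hφ.smooth.continuous hφ.compact), h φ hφ, h' φ hφ]
  ring

theorem HasWeakPartial.smul {Ω : Opens Pt} {i : Fin 2} {v w : L2 Ω} (c : ℝ)
    (h : HasWeakPartial Ω i v w) : HasWeakPartial Ω i (c • v) (c • w) := by
  intro φ hφ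
  have e1 : ∫ x in (Ω : Set Pt), (c • v) x * cpartial i φ x =
      ∫ x in (Ω : Set Pt), c * (v x * cpartial i φ x) := by
    apply integral_congr_ae
    filter_upwards [Lp.coeFn_smul c v] with x hx
    rw [hx, Pi.smul_apply, smul_eq_mul, mul_assoc]
  have e2 : ∫ x in (Ω : Set Pt), (c • w) x * φ x =
      ∫ x in (Ω : Set Pt), c * (w x * φ x) := by
    apply integral_congr_ae
    filter_upwards [Lp.coeFn_smul c w] with x hx
    rw [hx, Pi.smul_apply, smul_eq_mul, mul_assoc]
  rw [e1, e2, integral_const_mul, integral_const_mul, h φ hφ]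
  ring

theorem hasWeakPartial_zero (Ω : Opens Pt) (i : Fin 2) :
    HasWeakPartial Ω i (0 : L2 Ω) 0 := by
  have h : ∀ f : Pt → ℝ, ∫ x in (Ω : Set Pt), (0 : L2 Ω) x * f x = 0 := by
    intro f
    rw [← integral_zero Pt ℝ (μ := volume.restrict (Ω : Set Pt))]
    apply integral_congr_ae
    filter_upwards [Lp.coeFn_zero ℝ 2 (volume.restrict (Ω : Set Pt))] with x hx
    rw [hx, Pi.zero_apply, zero_mul]
  intro φ _
  rw [h, h, neg_zero]

/-- The Sobolev space `H¹(Ω)`. -/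
def H1 (Ω : Opens Pt) : Submodule ℝ (L2 Ω) where
  carrier := {v | ∀ i, ∃ w, HasWeakPartial Ω i v w}
  add_mem' := fun hu hv i =>
    let ⟨_, h⟩ := hu i
    let ⟨_, h'⟩ := hv i
    ⟨_, h.add h'⟩
  zero_mem' := fun i => ⟨0, hasWeakPartial_zero Ω i⟩
  smul_mem' := fun c _ hu i =>
    let ⟨_, h⟩ := hu i
    ⟨_, h.smul c⟩

open Classical in
/-- The weak partial derivative `∂_i v` (the value `0` where it does not exist). -/
def wpartial {Ω : Opens Pt} (i : Fin 2) (v : L2 Ω) : L2 Ω :=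
  if h : ∃ w, HasWeakPartial Ω i v w then h.choose else 0

theorem HasWeakPartial.wpartial_eq {Ω : Opens Pt} {i : Fin 2} {v w : L2 Ω}
    (h : HasWeakPartial Ω i v w) : wpartial i v = w := by
  have hex : ∃ w, HasWeakPartial Ω i v w := ⟨w, h⟩
  rw [wpartial, dif_pos hex]
  exact hex.choose_spec.unique h

theorem hasWeakPartial_wpartial {Ω : Opens Pt} {v : L2 Ω} (hv : v ∈ H1 Ω) (i : Fin 2) :
    HasWeakPartial Ω i v (wpartial i v) := by
  obtain ⟨w, h⟩ := hv i
  rwa [h.wpartial_eq]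

theorem wpartial_zero {Ω : Opens Pt} (i : Fin 2) : wpartial i (0 : L2 Ω) = 0 :=
  (hasWeakPartial_zero Ω i).wpartial_eq

theorem wpartial_add {Ω : Opens Pt} (i : Fin 2) {u v : L2 Ω} (hu : u ∈ H1 Ω) (hv : v ∈ H1 Ω) :
    wpartial i (u + v) = wpartial i u + wpartial i v :=
  ((hasWeakPartial_wpartial hu i).add (hasWeakPartial_wpartial hv i)).wpartial_eq

theorem wpartial_smul {Ω : Opens Pt} (i : Fin 2) (c : ℝ) {u : L2 Ω} (hu : u ∈ H1 Ω) :
    wpartial i (c • u) = c • wpartial i u :=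
  ((hasWeakPartial_wpartial hu i).smul c).wpartial_eq

/-- The Sobolev space `H²(Ω)`. -/
def H2 (Ω : Opens Pt) : Submodule ℝ (L2 Ω) where
  carrier := {v | v ∈ H1 Ω ∧ ∀ i, wpartial i v ∈ H1 Ω}
  add_mem' := fun hu hv => ⟨add_mem hu.1 hv.1, fun i => by
    rw [wpartial_add i hu.1 hv.1]
    exact add_mem (hu.2 i) (hv.2 i)⟩
  zero_mem' := ⟨zero_mem _, fun i => by
    rw [wpartial_zero]
    exact zero_mem _⟩
  smul_mem' := fun c _ hu => ⟨Submodule.smul_mem _ c hu.1, fun i => by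
    rw [wpartial_smul i c hu.1]
    exact Submodule.smul_mem _ c (hu.2 i)⟩

theorem ae_add {Ω : Opens Pt} {u v : L2 Ω} {f g : Pt → ℝ}
    (hu : u =ᵐ[volume.restrict (Ω : Set Pt)] f) (hv : v =ᵐ[volume.restrict (Ω : Set Pt)] g) :
    (u + v : L2 Ω) =ᵐ[volume.restrict (Ω : Set Pt)] f + g :=
  (Lp.coeFn_add u v).trans (hu.add hv)

theorem ae_smul {Ω : Opens Pt} {u : L2 Ω} {f : Pt → ℝ} (c : ℝ)
    (hu : u =ᵐ[volume.restrict (Ω : Set Pt)] f) :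
    (c • u : L2 Ω) =ᵐ[volume.restrict (Ω : Set Pt)] c • f :=
  (Lp.coeFn_smul c u).trans (hu.const_smul c)

/-- The triples `(φ, ∇φ)` with `φ ∈ C_c^∞(Ω)`, as a subspace of `L²(Ω) × L²(Ω)²`. -/
def testJet1 (Ω : Opens Pt) : Submodule ℝ (L2 Ω × (Fin 2 → L2 Ω)) where
  carrier := {z | ∃ φ : Pt → ℝ, IsTest Ω φ ∧ z.1 =ᵐ[volume.restrict (Ω : Set Pt)] φ ∧
    ∀ i, z.2 i =ᵐ[volume.restrict (Ω : Set Pt)] cpartial i φ}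
  add_mem' := by
    rintro y z ⟨φ, hφ, h0, h1⟩ ⟨ψ, hψ, g0, g1⟩
    refine ⟨φ + ψ, hφ.add hψ, ae_add h0 g0, fun i => ?_⟩
    rw [cpartial_add i hφ.smooth hψ.smooth]
    exact ae_add (h1 i) (g1 i)
  zero_mem' := by
    refine ⟨0, isTest_zero Ω, Lp.coeFn_zero _ _ _, fun i => ?_⟩
    rw [cpartial_zero]
    exact Lp.coeFn_zero _ _ _
  smul_mem' := by
    rintro c z ⟨φ, hφ, h0, h1⟩
    refine ⟨c • φ, hφ.smul c, ae_smul c h0, fun i => ?_⟩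
    rw [cpartial_smul i c hφ.smooth]
    exact ae_smul c (h1 i)

/-- The tuples `(φ, ∇φ, D²φ)` with `φ ∈ C_c^∞(Ω)`. -/
def testJet2 (Ω : Opens Pt) :
    Submodule ℝ (L2 Ω × (Fin 2 → L2 Ω) × (Fin 2 → Fin 2 → L2 Ω)) where
  carrier := {z | ∃ φ : Pt → ℝ, IsTest Ω φ ∧ z.1 =ᵐ[volume.restrict (Ω : Set Pt)] φ ∧
    (∀ i, z.2.1 i =ᵐ[volume.restrict (Ω : Set Pt)] cpartial i φ) ∧
    ∀ i j, z.2.2 i j =ᵐ[volume.restrict (Ω : Set Pt)] cpartial i (cpartial j φ)}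
  add_mem' := by
    rintro y z ⟨φ, hφ, h0, h1, h2⟩ ⟨ψ, hψ, g0, g1, g2⟩
    refine ⟨φ + ψ, hφ.add hψ, ae_add h0 g0, fun i => ?_, fun i j => ?_⟩
    · rw [cpartial_add i hφ.smooth hψ.smooth]
      exact ae_add (h1 i) (g1 i)
    · rw [cpartial_add j hφ.smooth hψ.smooth,
        cpartial_add i (contDiff_cpartial j hφ.smooth) (contDiff_cpartial j hψ.smooth)]
      exact ae_add (h2 i j) (g2 i j)
  zero_mem' := by
    refine ⟨0, isTest_zero Ω, Lp.coeFn_zero _ _ _, fun i => ?_, fun i j => ?_⟩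
    · rw [cpartial_zero]
      exact Lp.coeFn_zero _ _ _
    · rw [cpartial_zero, cpartial_zero]
      exact Lp.coeFn_zero _ _ _
  smul_mem' := by
    rintro c z ⟨φ, hφ, h0, h1, h2⟩
    refine ⟨c • φ, hφ.smul c, ae_smul c h0, fun i => ?_, fun i j => ?_⟩
    · rw [cpartial_smul i c hφ.smooth]
      exact ae_smul c (h1 i)
    · rw [cpartial_smul j c hφ.smooth, cpartial_smul i c (contDiff_cpartial j hφ.smooth)]
      exact ae_smul c (h2 i j)

/-- `H¹₀(Ω)`: the closure of `C_c^∞(Ω)` in `H¹(Ω)`. -/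
def H10 (Ω : Opens Pt) : Submodule ℝ (L2 Ω) where
  carrier := {v | v ∈ H1 Ω ∧
    (v, fun i => wpartial i v) ∈ closure (testJet1 Ω : Set (L2 Ω × (Fin 2 → L2 Ω)))}
  add_mem' := by
    rintro u v ⟨hu, hu'⟩ ⟨hv, hv'⟩
    refine ⟨add_mem hu hv, ?_⟩
    have h := add_mem (S := Submodule ℝ (L2 Ω × (Fin 2 → L2 Ω)))
      (s := (testJet1 Ω).topologicalClosure) hu' hv'
    have e : (u + v, fun i => wpartial i (u + v)) =
        (u, fun i => wpartial i u) + (v, fun i => wpartial i v) := by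
      simp only [wpartial_add _ hu hv]
      rfl
    rw [e]
    exact h
  zero_mem' := by
    refine ⟨zero_mem _, subset_closure ?_⟩
    simp only [wpartial_zero]
    exact zero_mem (testJet1 Ω)
  smul_mem' := by
    rintro c u ⟨hu, hu'⟩
    refine ⟨Submodule.smul_mem _ c hu, ?_⟩
    have h := Submodule.smul_mem (testJet1 Ω).topologicalClosure c hu'
    have e : (c • u, fun i => wpartial i (c • u)) = c • (u, fun i => wpartial i u) := by
      simp only [wpartial_smul _ c hu]
      rfl
    rw [e]
    exact h

/-- `H²₀(Ω)`: the closure of `C_c^∞(Ω)` in `H²(Ω)`. -/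
def H20 (Ω : Opens Pt) : Submodule ℝ (L2 Ω) where
  carrier := {v | v ∈ H2 Ω ∧
    (v, (fun i => wpartial i v), fun i j => wpartial i (wpartial j v)) ∈
      closure (testJet2 Ω : Set (L2 Ω × (Fin 2 → L2 Ω) × (Fin 2 → Fin 2 → L2 Ω)))}
  add_mem' := by
    rintro u v ⟨hu, hu'⟩ ⟨hv, hv'⟩
    refine ⟨add_mem hu hv, ?_⟩
    have h := add_mem (S := Submodule ℝ (L2 Ω × (Fin 2 → L2 Ω) × (Fin 2 → Fin 2 → L2 Ω)))
      (s := (testJet2 Ω).topologicalClosure) hu' hv'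
    have e : (u + v, (fun i => wpartial i (u + v)), fun i j => wpartial i (wpartial j (u + v))) =
        (u, (fun i => wpartial i u), fun i j => wpartial i (wpartial j u)) +
        (v, (fun i => wpartial i v), fun i j => wpartial i (wpartial j v)) := by
      simp only [wpartial_add _ hu.1 hv.1, wpartial_add _ (hu.2 _) (hv.2 _)]
      rfl
    rw [e]
    exact h
  zero_mem' := by
    refine ⟨zero_mem _, subset_closure ?_⟩
    simp only [wpartial_zero]
    exact zero_mem (testJet2 Ω)
  smul_mem' := by
    rintro c u ⟨hu, hu'⟩
    refine ⟨Submodule.smul_mem _ c hu, ?_⟩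
    have h := Submodule.smul_mem (testJet2 Ω).topologicalClosure c hu'
    have e : (c • u, (fun i => wpartial i (c • u)), fun i j => wpartial i (wpartial j (c • u))) =
        c • (u, (fun i => wpartial i u), fun i j => wpartial i (wpartial j u)) := by
      simp only [wpartial_smul _ c hu.1, wpartial_smul _ c (hu.2 _)]
      rfl
    rw [e]
    exact h

/-! ### Differential operators and bilinear forms -/

/-- `curl φ = (∂_y φ, -∂_x φ)`. -/
def curl {Ω : Opens Pt} (φ : L2 Ω) : L2 Ω × L2 Ω := (wpartial 1 φ, -wpartial 0 φ)

/-- `div v = ∂_x v₁ + ∂_y v₂`. -/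
def div {Ω : Opens Pt} (v : L2 Ω × L2 Ω) : L2 Ω := wpartial 0 v.1 + wpartial 1 v.2

/-- `a(u, v) = ∫_Ω ∇u : ∇v`. -/
def a {Ω : Opens Pt} (u v : L2 Ω × L2 Ω) : ℝ :=
  ∑ j, (inner ℝ (wpartial j u.1) (wpartial j v.1) + inner ℝ (wpartial j u.2) (wpartial j v.2))

theorem a_add_left {Ω : Opens Pt} {u v w : L2 Ω × L2 Ω} (hu : u ∈ (H1 Ω).prod (H1 Ω))
    (hv : v ∈ (H1 Ω).prod (H1 Ω)) : a (u + v) w = a u w + a v w := by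
  simp only [a, Prod.fst_add, Prod.snd_add, wpartial_add _ hu.1 hv.1, wpartial_add _ hu.2 hv.2,
    inner_add_left, ← Finset.sum_add_distrib]
  exact Finset.sum_congr rfl fun _ _ => by ring

theorem a_smul_left {Ω : Opens Pt} {u w : L2 Ω × L2 Ω} (c : ℝ) (hu : u ∈ (H1 Ω).prod (H1 Ω)) :
    a (c • u) w = c * a u w := by
  simp only [a, Prod.smul_fst, Prod.smul_snd, wpartial_smul _ c hu.1, wpartial_smul _ c hu.2,
    real_inner_smul_left, Finset.mul_sum, mul_add]

theorem a_zero_left {Ω : Opens Pt} (w : L2 Ω × L2 Ω) : a 0 w = 0 := by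
  simp [a, wpartial_zero]

theorem curl_mem {Ω : Opens Pt} {φ : L2 Ω} (h : φ ∈ H2 Ω) : curl φ ∈ (H1 Ω).prod (H1 Ω) :=
  ⟨h.2 1, neg_mem (h.2 0)⟩

theorem curl_add {Ω : Opens Pt} {φ ψ : L2 Ω} (h : φ ∈ H1 Ω) (h' : ψ ∈ H1 Ω) :
    curl (φ + ψ) = curl φ + curl ψ := by
  simp only [curl, wpartial_add _ h h', Prod.mk_add_mk, neg_add]

theorem curl_smul {Ω : Opens Pt} {φ : L2 Ω} (c : ℝ) (h : φ ∈ H1 Ω) :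
    curl (c • φ) = c • curl φ := by
  simp only [curl, wpartial_smul _ c h, Prod.smul_mk, smul_neg]

theorem curl_zero {Ω : Opens Pt} : curl (0 : L2 Ω) = 0 := by
  simp only [curl, wpartial_zero, neg_zero]
  rfl

theorem div_add {Ω : Opens Pt} {u v : L2 Ω × L2 Ω} (hu : u ∈ (H1 Ω).prod (H1 Ω))
    (hv : v ∈ (H1 Ω).prod (H1 Ω)) : div (u + v) = div u + div v := by
  simp only [div, Prod.fst_add, Prod.snd_add, wpartial_add _ hu.1 hv.1, wpartial_add _ hu.2 hv.2]
  abel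

theorem div_smul {Ω : Opens Pt} {u : L2 Ω × L2 Ω} (c : ℝ) (hu : u ∈ (H1 Ω).prod (H1 Ω)) :
    div (c • u) = c • div u := by
  simp only [div, Prod.smul_fst, Prod.smul_snd, wpartial_smul _ c hu.1, wpartial_smul _ c hu.2,
    smul_add]

theorem div_zero {Ω : Opens Pt} : div (0 : L2 Ω × L2 Ω) = 0 := by
  simp [div, wpartial_zero]

/-! ### Polygons and meshes -/

/-- A (nondegenerate) triangle; the closed element is `K.closedInterior`, the open one
`K.interior`. -/
abbrev Tri := Affine.Triangle ℝ Pt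

/-- `Ω` is the bounded plane domain enclosed by the simple closed polygon `P`, whose vertices
`P 0, …, P (n-1)` are true corners. Such a domain is simply connected. -/
structure IsPolygonalDomain {n : ℕ} [NeZero n] (Ω : Opens Pt) (P : Polygon Pt n) : Prop where
  nondegenerate : P.HasNondegenerateVertices ℝ
  injective : Function.Injective P.vertices
  simple : ∀ i j, i ≠ j → P.edgeSet ℝ i ∩ P.edgeSet ℝ j ⊆
    {P i, P (finRotate n i)} ∩ {P j, P (finRotate n j)}
  connected : IsConnected (Ω : Set Pt)
  bounded : Bornology.IsBounded (Ω : Set Pt)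
  frontier_eq : frontier (Ω : Set Pt) = P.boundary ℝ

/-- `T` is a conforming partition of `Ω` into triangles: two distinct elements are disjoint or
meet in a single common vertex or in a single common edge. -/
structure IsMesh (Ω : Opens Pt) (T : Finset Tri) : Prop where
  interior_subset : ∀ K ∈ T, K.interior ⊆ (Ω : Set Pt)
  cover : ⋃ K ∈ T, K.closedInterior = closure (Ω : Set Pt)
  conforming : ∀ K ∈ T, ∀ K' ∈ T, K ≠ K' →
    K.closedInterior ∩ K'.closedInterior = ∅ ∨
    (∃ x ∈ Set.range K.points ∩ Set.range K'.points,
      K.closedInterior ∩ K'.closedInterior = {x}) ∨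
    (∃ x ∈ Set.range K.points ∩ Set.range K'.points,
      ∃ y ∈ Set.range K.points ∩ Set.range K'.points, x ≠ y ∧
        K.closedInterior ∩ K'.closedInterior = segment ℝ x y)

/-! ### Piecewise polynomials -/

/-- Polynomials in the two coordinates of the plane. -/
abbrev Poly := MvPolynomial (Fin 2) ℝ

/-- Evaluation of a polynomial at a point, linear in the polynomial. -/
def evalAt (x : Pt) : Poly →ₗ[ℝ] ℝ := (MvPolynomial.aeval (fun i => x i)).toLinearMap

/-- The partial derivative `∂_i`. -/
def pd (i : Fin 2) : Module.End ℝ Poly := (MvPolynomial.pderiv i).toLinearMap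

/-- `v|_K = p`. -/
def HasPiece (Ω : Opens Pt) (K : Tri) (v : L2 Ω) (p : Poly) : Prop :=
  ∀ᵐ x ∂(volume.restrict (Ω : Set Pt)), x ∈ K.closedInterior → v x = evalAt x p

theorem HasPiece.add {Ω : Opens Pt} {K : Tri} {u v : L2 Ω} {p q : Poly}
    (h : HasPiece Ω K u p) (h' : HasPiece Ω K v q) : HasPiece Ω K (u + v) (p + q) := by
  filter_upwards [h, h', Lp.coeFn_add u v] with x hx hx' e hm
  rw [e, Pi.add_apply, hx hm, hx' hm, map_add]

theorem HasPiece.smul {Ω : Opens Pt} {K : Tri} {u : L2 Ω} {p : Poly} (c : ℝ)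
    (h : HasPiece Ω K u p) : HasPiece Ω K (c • u) (c • p) := by
  filter_upwards [h, Lp.coeFn_smul c u] with x hx e hm
  rw [e, Pi.smul_apply, hx hm, map_smul]

theorem hasPiece_zero (Ω : Opens Pt) (K : Tri) : HasPiece Ω K 0 0 := by
  filter_upwards [Lp.coeFn_zero ℝ 2 (volume.restrict (Ω : Set Pt))] with x e _
  rw [e, Pi.zero_apply, map_zero]

/-- All partial derivatives of order at most `m` of `p` and `q` agree at `x`. -/
def SameJet (m : ℕ) (x : Pt) (p q : Poly) : Prop :=
  ∀ i j : ℕ, i + j ≤ m → evalAt x ((pd 0 ^ i) ((pd 1 ^ j) p)) = evalAt x ((pd 0 ^ i) ((pd 1 ^ j) q))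

/-- Functions on `Ω` that are polynomials of degree at most `d` on each element and `C^m` at the
noncorner vertices (those element vertices that are not vertices of the polygon `P`): the pieces
on the elements around such a vertex have the same derivatives up to order `m` there. -/
def piecewisePoly {n : ℕ} (Ω : Opens Pt) (P : Polygon Pt n) (T : Finset Tri) (d m : ℕ) :
    Submodule ℝ (L2 Ω) where
  carrier := {v | ∃ p : Tri → Poly,
    (∀ K ∈ T, (p K).totalDegree ≤ d ∧ HasPiece Ω K v (p K)) ∧
    ∀ x, x ∉ Set.range P.vertices → ∀ K ∈ T, ∀ K' ∈ T,
      x ∈ Set.range K.points → x ∈ Set.range K'.points → SameJet m x (p K) (p K')}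
  add_mem' := by
    rintro u v ⟨p, h, h'⟩ ⟨q, g, g'⟩
    refine ⟨p + q, fun K hK => ⟨?_, (h K hK).2.add (g K hK).2⟩, ?_⟩
    · exact (MvPolynomial.totalDegree_add _ _).trans (max_le (h K hK).1 (g K hK).1)
    · intro x hx K hK K' hK' hm hm' i j hij
      simp only [Pi.add_apply, map_add, h' x hx K hK K' hK' hm hm' i j hij,
        g' x hx K hK K' hK' hm hm' i j hij]
  zero_mem' := ⟨0, fun K _ => ⟨by simp, hasPiece_zero Ω K⟩, fun _ _ _ _ _ _ _ _ _ _ _ => rfl⟩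
  smul_mem' := by
    rintro c u ⟨p, h, h'⟩
    refine ⟨c • p, fun K hK => ⟨?_, (h K hK).2.smul c⟩, ?_⟩
    · exact (MvPolynomial.totalDegree_smul_le c (p K)).trans (h K hK).1
    · intro x hx K hK K' hK' hm hm' i j hij
      simp only [Pi.smul_apply, map_smul, h' x hx K hK K' hK' hm hm' i j hij]

/-- `L²₀(Ω)`. -/
def L20 (Ω : Opens Pt) : Submodule ℝ (L2 Ω) where
  carrier := {q | Integrable q (volume.restrict (Ω : Set Pt)) ∧ ∫ x in (Ω : Set Pt), q x = 0}
  add_mem' := by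
    rintro p q ⟨h, h'⟩ ⟨g, g'⟩
    refine ⟨(h.add g).congr (Lp.coeFn_add p q).symm, ?_⟩
    rw [integral_congr_ae (Lp.coeFn_add p q)]
    simp only [Pi.add_apply]
    rw [integral_add h g, h', g', add_zero]
  zero_mem' := by
    refine ⟨(integrable_zero _ _ _).congr (Lp.coeFn_zero ℝ 2 _).symm, ?_⟩
    rw [integral_congr_ae (Lp.coeFn_zero ℝ 2 _)]
    simp
  smul_mem' := by
    rintro c q ⟨h, h'⟩
    refine ⟨(h.smul c).congr (Lp.coeFn_smul c q).symm, ?_⟩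
    rw [integral_congr_ae (Lp.coeFn_smul c q)]
    simp only [Pi.smul_apply]
    rw [integral_smul, h', smul_zero]

/-! ### The global spaces -/

section Spaces

variable {n : ℕ} (Ω : Opens Pt) (P : Polygon Pt n) (T : Finset Tri) (k : ℕ)

/-- `Σ₀`. -/
def Sigma0 : Submodule ℝ (L2 Ω) := H20 Ω ⊓ piecewisePoly Ω P T (k + 1) 2

/-- The scalar space `V`. -/
def V : Submodule ℝ (L2 Ω) := H1 Ω ⊓ piecewisePoly Ω P T k 1

/-- The vector space `𝐕₀ = V₀ × V₀`, with `V₀ = V ∩ H¹₀(Ω)`. -/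
def V0 : Submodule ℝ (L2 Ω × L2 Ω) := (V Ω P T k ⊓ H10 Ω).prod (V Ω P T k ⊓ H10 Ω)

/-- The space `Q`. -/
def Q : Submodule ℝ (L2 Ω) := piecewisePoly Ω P T (k - 1) 0

/-- `Q₀ = Q ∩ L²₀(Ω)`. -/
def Q0 : Submodule ℝ (L2 Ω) := Q Ω P T k ⊓ L20 Ω

/-! ### The interior spaces -/

variable {Ω} in
/-- `v|_{∂K} = 0`, where `∂K` is the union of the three edges of `K`. -/
def ZeroOnBoundary (K : Tri) (v : L2 Ω) : Prop :=
  ∃ p : Poly, HasPiece Ω K v p ∧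
    ∀ i j, i ≠ j → ∀ x ∈ segment ℝ (K.points i) (K.points j), evalAt x p = 0

variable {Ω} in
/-- `∂_n v|_{∂K} = 0`: on each edge, the derivative in each direction normal to it vanishes. -/
def ZeroNormalDerivOnBoundary (K : Tri) (v : L2 Ω) : Prop :=
  ∃ p : Poly, HasPiece Ω K v p ∧
    ∀ i j, i ≠ j → ∀ x ∈ segment ℝ (K.points i) (K.points j),
      ∀ ν : Pt, inner ℝ ν (K.points j - K.points i) = 0 →
        ∑ l, ν l * evalAt x (pd l p) = 0

variable {Ω} in
/-- `q|_K` vanishes at the vertices of `K`. -/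
def ZeroAtVertices (K : Tri) (v : L2 Ω) : Prop :=
  ∃ p : Poly, HasPiece Ω K v p ∧ ∀ i, evalAt (K.points i) p = 0

/-- `Σ_I`. -/
def SigmaI : Submodule ℝ (L2 Ω) where
  carrier := {φ | φ ∈ Sigma0 Ω P T k ∧
    ∀ K ∈ T, ZeroOnBoundary K φ ∧ ZeroNormalDerivOnBoundary K φ}
  add_mem' := by
    rintro u v ⟨hu, hu'⟩ ⟨hv, hv'⟩
    refine ⟨add_mem hu hv, fun K hK => ?_⟩
    obtain ⟨⟨p, h1, h2⟩, p', h3, h4⟩ := hu' K hK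
    obtain ⟨⟨q, g1, g2⟩, q', g3, g4⟩ := hv' K hK
    refine ⟨⟨p + q, h1.add g1, fun i j hij x hx => ?_⟩,
      p' + q', h3.add g3, fun i j hij x hx ν hν => ?_⟩
    · rw [map_add, h2 i j hij x hx, g2 i j hij x hx, add_zero]
    · simp only [map_add, mul_add, Finset.sum_add_distrib]
      rw [h4 i j hij x hx ν hν, g4 i j hij x hx ν hν, add_zero]
  zero_mem' := ⟨zero_mem _, fun K _ => ⟨⟨0, hasPiece_zero Ω K, by simp⟩,
    0, hasPiece_zero Ω K, by simp⟩⟩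
  smul_mem' := by
    rintro c u ⟨hu, hu'⟩
    refine ⟨Submodule.smul_mem _ c hu, fun K hK => ?_⟩
    obtain ⟨⟨p, h1, h2⟩, p', h3, h4⟩ := hu' K hK
    refine ⟨⟨c • p, h1.smul c, fun i j hij x hx => ?_⟩,
      c • p', h3.smul c, fun i j hij x hx ν hν => ?_⟩
    · rw [map_smul, h2 i j hij x hx, smul_zero]
    · have := h4 i j hij x hx ν hν
      simp only [map_smul, smul_eq_mul, mul_left_comm _ c, ← Finset.mul_sum]
      rw [this, mul_zero]

/-- `𝐕_I`. -/
def VI : Submodule ℝ (L2 Ω × L2 Ω) where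
  carrier := {v | v ∈ V0 Ω P T k ∧ ∀ K ∈ T, ZeroOnBoundary K v.1 ∧ ZeroOnBoundary K v.2}
  add_mem' := by
    rintro u v ⟨hu, hu'⟩ ⟨hv, hv'⟩
    refine ⟨add_mem hu hv, fun K hK => ?_⟩
    obtain ⟨⟨p, h1, h2⟩, p', h3, h4⟩ := hu' K hK
    obtain ⟨⟨q, g1, g2⟩, q', g3, g4⟩ := hv' K hK
    refine ⟨⟨p + q, h1.add g1, fun i j hij x hx => ?_⟩,
      p' + q', h3.add g3, fun i j hij x hx => ?_⟩
    · rw [map_add, h2 i j hij x hx, g2 i j hij x hx, add_zero]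
    · rw [map_add, h4 i j hij x hx, g4 i j hij x hx, add_zero]
  zero_mem' := ⟨zero_mem _, fun K _ => ⟨⟨0, hasPiece_zero Ω K, by simp⟩,
    0, hasPiece_zero Ω K, by simp⟩⟩
  smul_mem' := by
    rintro c u ⟨hu, hu'⟩
    refine ⟨Submodule.smul_mem _ c hu, fun K hK => ?_⟩
    obtain ⟨⟨p, h1, h2⟩, p', h3, h4⟩ := hu' K hK
    refine ⟨⟨c • p, h1.smul c, fun i j hij x hx => ?_⟩,
      c • p', h3.smul c, fun i j hij x hx => ?_⟩
    · rw [map_smul, h2 i j hij x hx, smul_zero]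
    · rw [map_smul, h4 i j hij x hx, smul_zero]

/-- `Q_I`; the integral is that of `q` over `K` (`K` lies in the closure of `Ω`). -/
def QI : Submodule ℝ (L2 Ω) where
  carrier := {q | q ∈ Q0 Ω P T k ∧
    ∀ K ∈ T, ∫ x in K.closedInterior, q x ∂(volume.restrict (Ω : Set Pt)) = 0 ∧
      ZeroAtVertices K q}
  add_mem' := by
    rintro u v ⟨hu, hu'⟩ ⟨hv, hv'⟩
    refine ⟨add_mem hu hv, fun K hK => ?_⟩
    obtain ⟨hi, p, h1, h2⟩ := hu' K hK
    obtain ⟨gi, q, g1, g2⟩ := hv' K hK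
    refine ⟨?_, p + q, h1.add g1, fun i => by rw [map_add, h2 i, g2 i, add_zero]⟩
    rw [integral_congr_ae (ae_restrict_of_ae (Lp.coeFn_add u v))]
    simp only [Pi.add_apply]
    rw [integral_add hu.2.1.integrableOn hv.2.1.integrableOn, hi, gi, add_zero]
  zero_mem' := by
    refine ⟨zero_mem _, fun K _ => ⟨?_, 0, hasPiece_zero Ω K, by simp⟩⟩
    rw [integral_congr_ae (ae_restrict_of_ae (Lp.coeFn_zero ℝ 2 _))]
    simp
  smul_mem' := by
    rintro c u ⟨hu, hu'⟩
    refine ⟨Submodule.smul_mem _ c hu, fun K hK => ?_⟩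
    obtain ⟨hi, p, h1, h2⟩ := hu' K hK
    refine ⟨?_, c • p, h1.smul c, fun i => by rw [map_smul, h2 i, smul_zero]⟩
    rw [integral_congr_ae (ae_restrict_of_ae (Lp.coeFn_smul c u))]
    simp only [Pi.smul_apply]
    rw [integral_smul, hi, smul_zero]

/-! ### The exterior spaces -/

/-- `Σ̃_E`. -/
def SigmaE : Submodule ℝ (L2 Ω) where
  carrier := {φ | φ ∈ Sigma0 Ω P T k ∧ ∀ ψ ∈ SigmaI Ω P T k, a (curl φ) (curl ψ) = 0}
  add_mem' := by
    rintro u v ⟨hu, hu'⟩ ⟨hv, hv'⟩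
    refine ⟨add_mem hu hv, fun ψ hψ => ?_⟩
    rw [curl_add hu.1.1.1 hv.1.1.1, a_add_left (curl_mem hu.1.1) (curl_mem hv.1.1),
      hu' ψ hψ, hv' ψ hψ, add_zero]
  zero_mem' := ⟨zero_mem _, fun ψ _ => by rw [curl_zero, a_zero_left]⟩
  smul_mem' := by
    rintro c u ⟨hu, hu'⟩
    refine ⟨Submodule.smul_mem _ c hu, fun ψ hψ => ?_⟩
    rw [curl_smul c hu.1.1.1, a_smul_left c (curl_mem hu.1.1), hu' ψ hψ, mul_zero]

/-- `Q̃_E`. -/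
def QE : Submodule ℝ (L2 Ω) where
  carrier := {q | q ∈ Q0 Ω P T k ∧ ∀ r ∈ QI Ω P T k, inner ℝ q r = 0}
  add_mem' := by
    rintro u v ⟨hu, hu'⟩ ⟨hv, hv'⟩
    refine ⟨add_mem hu hv, fun r hr => ?_⟩
    rw [inner_add_left, hu' r hr, hv' r hr, add_zero]
  zero_mem' := ⟨zero_mem _, fun r _ => inner_zero_left r⟩
  smul_mem' := by
    rintro c u ⟨hu, hu'⟩
    refine ⟨Submodule.smul_mem _ c hu, fun r hr => ?_⟩
    rw [real_inner_smul_left, hu' r hr, mul_zero]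

theorem V0_le : V0 Ω P T k ≤ (H1 Ω).prod (H1 Ω) := fun _ hv => ⟨hv.1.1.1, hv.2.1.1⟩

/-- `𝐕̃_E`. -/
def VE : Submodule ℝ (L2 Ω × L2 Ω) where
  carrier := {v | v ∈ V0 Ω P T k ∧ div v ∈ QE Ω P T k ∧
    ∀ ψ ∈ SigmaI Ω P T k, a v (curl ψ) = 0}
  add_mem' := by
    rintro u v ⟨hu, hd, hu'⟩ ⟨hv, gd, hv'⟩
    have h1 := V0_le Ω P T k hu
    have h2 := V0_le Ω P T k hv
    refine ⟨add_mem hu hv, ?_, fun ψ hψ => ?_⟩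
    · rw [div_add h1 h2]
      exact add_mem hd gd
    · rw [a_add_left h1 h2, hu' ψ hψ, hv' ψ hψ, add_zero]
  zero_mem' := ⟨zero_mem _, by rw [div_zero]; exact zero_mem _, fun ψ _ => a_zero_left _⟩
  smul_mem' := by
    rintro c u ⟨hu, hd, hu'⟩
    have h1 := V0_le Ω P T k hu
    refine ⟨Submodule.smul_mem _ c hu, ?_, fun ψ hψ => ?_⟩
    · rw [div_smul c h1]
      exact Submodule.smul_mem _ c hd
    · rw [a_smul_left c h1, hu' ψ hψ, mul_zero]

end Spaces

/-- `A = B ⊕ C` (internal direct sum of subspaces). -/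
def IsDirectSum {E : Type*} [AddCommGroup E] [Module ℝ E] (A B C : Submodule ℝ E) : Prop :=
  A = B ⊔ C ∧ B ⊓ C = ⊥

end StokesFE

end

noncomputable section

namespace StokesFE

/-! ### Polynomials in two variables -/

/-! All three decompositions follow from the exactness of the interior complex Σ_I → 𝐕_I → Q_I, with
maps curl and div. This exactness is local. An interior function vanishes on every element boundary,
so its pieces can be treated one triangle at a time and glued back with no matching conditions.

Let b be the cubic bubble of K. A polynomial vanishing on ∂K is a multiple of b (`bubble_dvd`). If
its gradient vanishes there too, it is a multiple of b² (`bubble_sq_dvd`). Hence a divergence-free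
field b(p, q) is the curl of some b²r (`exists_stream_bubble`). This gives exactness at 𝐕_I and the
dimension of the kernel of div on bubble fields. Rank-nullity then shows that div maps the bubble
fields onto the polynomials that have zero mean and vanish at the vertices (`exists_divBubble_eq`).

To return to Sobolev spaces, bq and b²q extended by zero must lie in H¹₀ and H²₀. They are cut off
by η(Nb) with N → ∞. Each derivative falling on the cutoff costs a factor N, which a factor b
absorbs, so all derivatives needed stay bounded and dominated convergence applies.

The splitting of Q₀ is orthogonal projection onto a finite-dimensional space. The splitting of Σ₀ is
the projection for a(curl ·, curl ·), which is definite on Σ_I because an interior field with zero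
gradient is constant on each element and vanishes on its boundary. For v in 𝐕₀, split div v = r + e
in Q₀, choose w in 𝐕_I with div w = r, and subtract from v - w its projection onto curl Σ_I. The
remainder is exterior. A field in 𝐕_I ∩ 𝐕̃_E has divergence in Q_I ∩ Q̃_E = 0, so it is a curl from
Σ_I orthogonal to itself. -/

theorem evalAt_mul (x : Pt) (p q : Poly) : evalAt x (p * q) = evalAt x p * evalAt x q := by
  simp [evalAt]

theorem evalAt_X (x : Pt) (i : Fin 2) : evalAt x (MvPolynomial.X i) = x i := by
  simp [evalAt]

theorem evalAt_C (x : Pt) (c : ℝ) : evalAt x (MvPolynomial.C c) = c := by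
  simp [evalAt]

theorem evalAt_one (x : Pt) : evalAt x 1 = 1 := by
  simp [evalAt]

theorem pd_mul (i : Fin 2) (p q : Poly) : pd i (p * q) = pd i p * q + p * pd i q :=
  MvPolynomial.pderiv_mul

theorem pd_C (i : Fin 2) (c : ℝ) : pd i (MvPolynomial.C c) = 0 := MvPolynomial.pderiv_C

theorem pd_comm (i j : Fin 2) (p : Poly) : pd i (pd j p) = pd j (pd i p) := by
  ext m
  simp only [pd, Derivation.coeFn_coe, MvPolynomial.coeff_pderiv]
  by_cases h : i = j
  · subst h; rfl
  · have h' : j ≠ i := Ne.symm h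
    simp [h, h', add_right_comm]
    ring

/-- The jet of ∂_l p is a shifted part of the jet of p. This is why differentiation turns C^(m+1) at
a vertex into C^m. -/
theorem pd_zero_pow_pd_one_pow_pd (l : Fin 2) (i j : ℕ) (p : Poly) :
    (pd 0 ^ i) ((pd 1 ^ j) (pd l p)) =
      if l = 0 then (pd 0 ^ (i + 1)) ((pd 1 ^ j) p) else (pd 0 ^ i) ((pd 1 ^ (j + 1)) p) := by
  have hc : ∀ (a b : Fin 2), Commute (pd a) (pd b) := fun a b => LinearMap.ext fun q => pd_comm a b q
  have h1 : (pd 1 ^ j) (pd l p) = pd l ((pd 1 ^ j) p) :=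
    LinearMap.congr_fun ((hc 1 l).pow_left j).eq p
  fin_cases l
  · simp only [Fin.zero_eta, if_true] at h1 ⊢
    rw [h1, pow_succ]; rfl
  · simp only [Fin.mk_one, one_ne_zero, if_false, pow_succ]
    rfl

/-! ### Degree filtration and dimensions. -/

/-- Polynomials all of whose monomials have degree less than `m`. -/
def degLT (m : ℕ) : Submodule ℝ Poly :=
  MvPolynomial.restrictSupport ℝ {s : Fin 2 →₀ ℕ | s 0 + s 1 < m}

theorem sum_fin_two (s : Fin 2 →₀ ℕ) : (s.sum fun _ e => e) = s 0 + s 1 := by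
  rw [Finsupp.sum_fintype _ _ (fun _ => rfl), Fin.sum_univ_two]

theorem mem_degLT_iff {m : ℕ} {p : Poly} : p ∈ degLT m ↔ ∀ s ∈ p.support, s 0 + s 1 < m :=
  Iff.rfl

theorem mem_degLT_succ {m : ℕ} {p : Poly} : p ∈ degLT (m + 1) ↔ p.totalDegree ≤ m := by
  rw [mem_degLT_iff, MvPolynomial.totalDegree, Finset.sup_le_iff]
  simp only [sum_fin_two, Nat.lt_succ_iff]

/-- The strict bound lets the zero space appear as `degLT 0`, as the dimension count requires in its
lowest case. -/
theorem degLT_zero : degLT 0 = ⊥ := by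
  rw [eq_bot_iff]
  intro p hp
  rw [mem_degLT_iff] at hp
  rw [Submodule.mem_bot, ← MvPolynomial.support_eq_empty, Finset.eq_empty_iff_forall_notMem]
  exact fun s hs => absurd (hp s hs) (Nat.not_lt_zero _)

theorem mem_degLT_iff_of_ne {m : ℕ} {p : Poly} (hp : p ≠ 0) : p ∈ degLT m ↔ p.totalDegree < m := by
  cases m with
  | zero => simp [degLT_zero, hp]
  | succ m => rw [mem_degLT_succ, Nat.lt_succ_iff]

/-- Degrees add in a domain, so dividing by a bubble lowers the degree bound by exactly the degree
of the bubble. -/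
theorem mul_mem_degLT_iff {m d : ℕ} {b q : Poly} (hb : b ≠ 0) (hd : b.totalDegree = d) :
    b * q ∈ degLT (m + d) ↔ q ∈ degLT m := by
  by_cases hq : q = 0
  · simp [hq]
  · rw [mem_degLT_iff_of_ne (mul_ne_zero hb hq), mem_degLT_iff_of_ne hq,
      MvPolynomial.totalDegree_mul_of_isDomain hb hq]
    omega

theorem eq_zero_of_mul_mem_degLT {m : ℕ} {b q : Poly} (h : b * q ∈ degLT m) (hb : b ≠ 0)
    (hd : m ≤ b.totalDegree) : q = 0 := by
  by_contra hq
  rw [mem_degLT_iff_of_ne (mul_ne_zero hb hq), MvPolynomial.totalDegree_mul_of_isDomain hb hq] at h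
  omega

/-- There are i + 1 monomials of degree i, indexed by the antidiagonal of i. The factor 2 avoids
division in ℕ. -/
theorem two_mul_finrank_degLT (m : ℕ) : 2 * Module.finrank ℝ (degLT m) = m * (m + 1) := by
  let F : Finset (Σ _ : ℕ, ℕ × ℕ) := (Finset.range m).sigma fun i =>
    Finset.HasAntidiagonal.antidiagonal i
  let e : {s : Fin 2 →₀ ℕ | s 0 + s 1 < m} ≃ F :=
    { toFun := fun s => ⟨⟨s.1 0 + s.1 1, (s.1 0, s.1 1)⟩, by
        have := s.2; simp only [Set.mem_ofPred_eq] at this; simp [F, this]⟩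
      invFun := fun t => ⟨Finsupp.single 0 t.1.2.1 + Finsupp.single 1 t.1.2.2, by
        have h := t.2
        simp only [F, Finset.mem_sigma, Finset.mem_range, Finset.HasAntidiagonal.mem_antidiagonal] at h
        simp [h.2, h.1]⟩
      left_inv := fun s => by
        ext i; fin_cases i <;> simp
      right_inv := fun t => by
        have h := t.2
        simp only [F, Finset.mem_sigma, Finset.mem_range, Finset.HasAntidiagonal.mem_antidiagonal] at h
        obtain ⟨⟨a, b, c⟩, ht⟩ := t
        simp only at h
        obtain ⟨h1, rfl⟩ := h
        simp }
  have h1 : Module.finrank ℝ (degLT m) = Nat.card {s : Fin 2 →₀ ℕ | s 0 + s 1 < m} :=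
    Module.finrank_eq_nat_card_basis (MvPolynomial.basisRestrictSupport ℝ _)
  have h2 : F.card = ∑ i ∈ Finset.range m, (i + 1) := by
    simp [F, Finset.card_sigma]
  rw [h1, Nat.card_congr e, Nat.card_eq_fintype_card, Fintype.card_coe, h2]
  clear e h1 h2 F
  induction m with
  | zero => simp
  | succ m ih => rw [Finset.sum_range_succ, mul_add, ih]; ring

instance finiteDimensional_degLT (m : ℕ) : FiniteDimensional ℝ (degLT m) := by
  have hf : Finite {s : Fin 2 →₀ ℕ | s 0 + s 1 < m} := by
    refine Finite.of_injective (β := Fin m × Fin m)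
      (fun s => (⟨s.1 0, lt_of_le_of_lt (Nat.le_add_right _ _) s.2⟩,
        ⟨s.1 1, lt_of_le_of_lt (Nat.le_add_left _ _) s.2⟩)) ?_
    intro s t h
    simp only [Prod.mk.injEq, Fin.mk.injEq] at h
    ext i
    fin_cases i
    · exact h.1
    · exact h.2
  exact Module.Basis.finiteDimensional_of_finite (MvPolynomial.basisRestrictSupport ℝ _)

theorem degLT_induction {m : ℕ} {C : Poly → Prop} (h0 : C 0) (hadd : ∀ p q, C p → C q → C (p + q))
    (hm : ∀ (s : Fin 2 →₀ ℕ) (c : ℝ), s 0 + s 1 < m → C (MvPolynomial.monomial s c))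
    {p : Poly} (hp : p ∈ degLT m) : C p := by
  rw [mem_degLT_iff] at hp
  rw [p.as_sum]
  exact Finset.sum_induction _ C hadd h0 fun s hs => hm s _ (hp s hs)

theorem pd_mem_degLT {m : ℕ} (i : Fin 2) {p : Poly} (hp : p ∈ degLT (m + 1)) :
    pd i p ∈ degLT m := by
  rw [mem_degLT_iff] at hp ⊢
  intro s hs
  rw [MvPolynomial.mem_support_iff, pd, Derivation.coeFn_coe, MvPolynomial.coeff_pderiv] at hs
  have := hp _ (MvPolynomial.mem_support_iff.2 (fun h => hs (by rw [h]; simp)))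
  fin_cases i <;> simp at this <;> omega

theorem totalDegree_pd_le {m : ℕ} (i : Fin 2) {p : Poly} (hp : p.totalDegree ≤ m) :
    (pd i p).totalDegree ≤ m - 1 := by
  cases m with
  | zero =>
    rw [Nat.le_zero, MvPolynomial.totalDegree_eq_zero_iff_eq_C] at hp
    rw [hp, pd_C]
    simp
  | succ m => exact mem_degLT_succ.1 (pd_mem_degLT i (mem_degLT_succ.2 hp))

/-! ### Antiderivatives and stream functions. -/

/-- The antiderivative in the variable `i` that vanishes where `x i = 0`. -/
def antideriv (i : Fin 2) : Poly →ₗ[ℝ] Poly :=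
  (MvPolynomial.basisMonomials (Fin 2) ℝ).constr ℝ fun s =>
    MvPolynomial.monomial (s + Finsupp.single i 1) ((s i + 1 : ℝ)⁻¹)

theorem antideriv_monomial (i : Fin 2) (s : Fin 2 →₀ ℕ) (c : ℝ) :
    antideriv i (MvPolynomial.monomial s c) =
      MvPolynomial.monomial (s + Finsupp.single i 1) (c * (s i + 1 : ℝ)⁻¹) := by
  have : MvPolynomial.monomial s c = c • (MvPolynomial.basisMonomials (Fin 2) ℝ s) := by
    simp [MvPolynomial.smul_monomial]
  rw [this, map_smul, antideriv, Module.Basis.constr_basis, MvPolynomial.smul_monomial, smul_eq_mul]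

theorem pd_antideriv (i : Fin 2) (p : Poly) : pd i (antideriv i p) = p := by
  induction p using MvPolynomial.induction_on' with
  | monomial s c =>
    rw [antideriv_monomial, pd, Derivation.coeFn_coe, MvPolynomial.pderiv_monomial]
    have : (s i + 1 : ℝ) ≠ 0 := by positivity
    congr 1
    · congr 1; simp
    · simp [mul_assoc, inv_mul_cancel₀ this]
  | add p q hp hq => rw [map_add, map_add, hp, hq]

theorem pd_antideriv_of_ne {i j : Fin 2} (h : j ≠ i) (p : Poly) :
    pd j (antideriv i p) = antideriv i (pd j p) := by
  induction p using MvPolynomial.induction_on' with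
  | monomial s c =>
    simp only [antideriv_monomial, pd, Derivation.coeFn_coe, MvPolynomial.pderiv_monomial]
    have h1 : (Finsupp.single i 1 : Fin 2 →₀ ℕ) j = 0 := by simp [h.symm]
    have h2 : (Finsupp.single j 1 : Fin 2 →₀ ℕ) i = 0 := by simp [h]
    -- If the exponent of `j` is zero, both sides vanish; otherwise the truncated subtraction is
    -- genuine and commutes with raising the exponent of `i`.
    by_cases hs : s j = 0
    · simp [h1, hs]
    · have e : s + Finsupp.single i 1 - Finsupp.single j 1 =
          s - Finsupp.single j 1 + Finsupp.single i 1 := by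
        ext l
        by_cases hl : l = j
        · subst hl; simp [h1]
        · have : (Finsupp.single j 1 : Fin 2 →₀ ℕ) l = 0 := by
            simp [Ne.symm hl]
          simp [this]
      rw [e]
      congr 1
      simp [h1, h2]
      ring
  | add p q hp hq => simp only [map_add, hp, hq]

theorem antideriv_mem_degLT {m : ℕ} (i : Fin 2) {p : Poly} (hp : p ∈ degLT m) :
    antideriv i p ∈ degLT (m + 1) := by
  refine degLT_induction (C := fun p => antideriv i p ∈ degLT (m + 1)) ?_ ?_ ?_ hp
  · simp
  · intro p q hp hq
    rw [map_add]
    exact add_mem hp hq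
  · intro s c hs
    rw [antideriv_monomial, degLT, MvPolynomial.monomial_mem_restrictSupport]
    left
    fin_cases i <;> simp <;> omega

/-- A divergence-free polynomial field is the curl of a polynomial. -/
theorem exists_stream_poly {m : ℕ} {p q : Poly} (hp : p ∈ degLT m) (hq : q ∈ degLT m)
    (h : pd 0 p + pd 1 q = 0) :
    ∃ φ ∈ degLT (m + 1), pd 1 φ = p ∧ pd 0 φ = -q := by
  -- The y-antiderivative of p already has the right y-derivative. The error in its x-derivative,
  -- ∂₀(∫p dy) + q, has y-derivative ∂₀p + ∂₁q = 0, so subtracting its x-antiderivative leaves the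
  -- y-derivative unchanged.
  refine ⟨antideriv 1 p - antideriv 0 (pd 0 (antideriv 1 p) + q), ?_, ?_, ?_⟩
  · exact sub_mem (antideriv_mem_degLT 1 hp)
      (antideriv_mem_degLT 0 (add_mem (pd_mem_degLT 0 (antideriv_mem_degLT 1 hp)) hq))
  · rw [map_sub, pd_antideriv, pd_antideriv_of_ne (by decide), map_add, pd_comm, pd_antideriv, h,
      map_zero, sub_zero]
  · rw [map_sub, pd_antideriv]
    ring

theorem eq_C_of_pd_eq_zero {p : Poly} (h : ∀ i, pd i p = 0) : ∃ c, p = MvPolynomial.C c := by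
  refine ⟨p.coeff 0, ?_⟩
  rw [← MvPolynomial.totalDegree_eq_zero_iff_eq_C, ← Nat.le_zero, ← mem_degLT_succ, mem_degLT_iff]
  intro s hs
  by_contra hne
  obtain ⟨i, hi⟩ : ∃ i, s i ≠ 0 := by
    by_contra! h0
    exact hne (by simp [h0])
  have h1 := congrArg (MvPolynomial.coeff (s - Finsupp.single i 1)) (h i)
  rw [pd, Derivation.coeFn_coe, MvPolynomial.coeff_pderiv, MvPolynomial.coeff_zero] at h1
  have e : s - Finsupp.single i 1 + Finsupp.single i 1 = s :=
    tsub_add_cancel_of_le (by rw [Finsupp.single_le_iff]; omega)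
  rw [e] at h1
  have h2 := mul_eq_zero.1 h1
  rcases h2 with h2 | h2
  · exact (MvPolynomial.mem_support_iff.1 hs) h2
  · have : (0 : ℝ) ≤ ((s - Finsupp.single i 1 : Fin 2 →₀ ℕ) i : ℝ) := by positivity
    linarith

/-! ### Polynomials as functions -/

theorem hasFDerivAt_evalAt (p : Poly) (x : Pt) :
    HasFDerivAt (fun y => evalAt y p)
      (∑ i, evalAt x (pd i p) • (EuclideanSpace.proj i : Pt →L[ℝ] ℝ)) x := by
  induction p using MvPolynomial.induction_on with
  | C c =>
    simp only [evalAt_C, pd_C, map_zero, zero_smul, Finset.sum_const_zero]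
    exact hasFDerivAt_const c x
  | add p q hp hq =>
    simp only [map_add, add_smul, Finset.sum_add_distrib]
    exact hp.add hq
  | mul_X p j hp =>
    simp only [pd_mul, evalAt_mul, evalAt_X, map_add]
    have h := hp.mul (EuclideanSpace.proj (𝕜 := ℝ) j : Pt →L[ℝ] ℝ).hasFDerivAt
    refine h.congr_fderiv ?_
    ext y
    fin_cases j <;> simp [Fin.sum_univ_two, pd, evalAt_one]
    all_goals ring

theorem cpartial_evalAt (i : Fin 2) (p : Poly) :
    cpartial i (fun x => evalAt x p) = fun x => evalAt x (pd i p) := by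
  funext x
  rw [cpartial, (hasFDerivAt_evalAt p x).fderiv]
  fin_cases i <;> simp [Fin.sum_univ_two]

theorem contDiff_evalAt (p : Poly) : ContDiff ℝ ∞ (fun x => evalAt x p) := by
  induction p using MvPolynomial.induction_on with
  | C c => simp only [evalAt_C]; exact contDiff_const
  | add p q hp hq => simp only [map_add]; exact hp.add hq
  | mul_X p j hp =>
    simp only [evalAt_mul, evalAt_X]
    exact hp.mul (EuclideanSpace.proj (𝕜 := ℝ) j : Pt →L[ℝ] ℝ).contDiff

theorem continuous_evalAt (p : Poly) : Continuous (fun x => evalAt x p) :=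
  (contDiff_evalAt p).continuous

/-- A nonempty open set contains a product of two intervals, and a polynomial vanishing on a product
of infinite sets is zero. -/
theorem eq_zero_of_evalAt_eq_zero_on_open {p : Poly} {U : Set Pt} (hU : IsOpen U)
    (hne : U.Nonempty) (h : ∀ x ∈ U, evalAt x p = 0) : p = 0 := by
  obtain ⟨x, hx⟩ := hne
  let e := (EuclideanSpace.equiv (Fin 2) ℝ)
  have hV : IsOpen (e.symm ⁻¹' U) := hU.preimage e.symm.continuous
  have hxV : e x ∈ e.symm ⁻¹' U := by simpa using hx
  obtain ⟨ε, hε, hball⟩ := Metric.isOpen_iff.1 hV _ hxV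
  refine MvPolynomial.funext_set (s := fun i => Metric.ball (e x i) ε) ?_ ?_
  · intro i
    rw [Real.ball_eq_Ioo]
    exact Set.Ioo_infinite (by linarith)
  · intro y hy
    rw [map_zero]
    have : y ∈ Metric.ball (e x) ε := by
      rw [ball_pi _ hε]; exact hy
    have := h _ (hball this)
    simpa [evalAt, e, MvPolynomial.aeval_eq_eval] using this

/-- The restriction to a line is a polynomial in t with infinitely many roots. Vanishing on an open
edge thus extends to the whole line, endpoints included. -/
theorem evalAt_eq_zero_on_line {p : Poly} {A B : Pt}
    (h : ∀ t ∈ Set.Ioo (0 : ℝ) 1, evalAt (A + t • (B - A)) p = 0) (t : ℝ) :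
    evalAt (A + t • (B - A)) p = 0 := by
  let f : Polynomial ℝ := MvPolynomial.aeval
    (fun i => Polynomial.C (A i) + Polynomial.X * Polynomial.C (B i - A i)) p
  have hf : ∀ t : ℝ, f.eval t = evalAt (A + t • (B - A)) p := by
    intro t
    change Polynomial.evalRingHom t f = _
    simp only [f, evalAt, MvPolynomial.aeval_def, AlgHom.toLinearMap_apply]
    rw [MvPolynomial.hom_eval₂]
    congr 1
    · ext; simp
    · funext i; simp
  have : f = 0 := Polynomial.eq_zero_of_infinite_isRoot f
    ((Set.Ioo_infinite (zero_lt_one (α := ℝ))).mono fun t ht => by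
      simp only [Set.mem_ofPred_eq, Polynomial.IsRoot, hf, h t ht])
  rw [← hf, this, Polynomial.eval_zero]

/-! ### Barycentric coordinates -/

/-- The vertices of a triangle, as an affine basis of the plane. -/
def Tri.basis (K : Tri) : AffineBasis (Fin 3) ℝ Pt :=
  ⟨K.points, K.independent,
    K.independent.affineSpan_eq_top_iff_card_eq_finrank_add_one.2 (by simp)⟩

/-- The `i`-th barycentric coordinate of `K`, as a polynomial. -/
def bary (K : Tri) (i : Fin 3) : Poly :=
  MvPolynomial.C (K.basis.coord i 0) + ∑ l, MvPolynomial.C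
    ((K.basis.coord i).linear (EuclideanSpace.single l 1)) * MvPolynomial.X l

theorem evalAt_bary (K : Tri) (i : Fin 3) (x : Pt) : evalAt x (bary K i) = K.basis.coord i x := by
  have hx : x = ∑ l, x l • (EuclideanSpace.single l (1 : ℝ) : Pt) := by
    ext m; fin_cases m <;> simp [Fin.sum_univ_two]
  have h : K.basis.coord i x = (K.basis.coord i).linear x + K.basis.coord i 0 :=
    congrFun (K.basis.coord i).decomp x
  have h2 : (K.basis.coord i).linear x =
      ∑ l, x l * (K.basis.coord i).linear (EuclideanSpace.single l 1) := by
    conv_lhs => rw [hx]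
    rw [map_sum]
    simp only [map_smul, smul_eq_mul]
  rw [h, h2, bary, map_add, map_sum, evalAt_C, add_comm]
  simp only [evalAt_mul, evalAt_C, evalAt_X, mul_comm]

theorem evalAt_bary_points (K : Tri) (i j : Fin 3) :
    evalAt (K.points j) (bary K i) = if i = j then 1 else 0 := by
  rw [evalAt_bary]
  exact K.basis.coord_apply i j

theorem evalAt_bary_line (K : Tri) (i : Fin 3) (A B : Pt) (t : ℝ) :
    evalAt (A + t • (B - A)) (bary K i) =
      (1 - t) * evalAt A (bary K i) + t * evalAt B (bary K i) := by
  simp only [bary, map_add, evalAt_mul, evalAt_C, evalAt_X, Fin.sum_univ_two]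
  simp
  ring

theorem sum_bary (K : Tri) : ∑ i, bary K i = 1 := by
  rw [← sub_eq_zero]
  refine eq_zero_of_evalAt_eq_zero_on_open isOpen_univ Set.univ_nonempty fun x _ => ?_
  rw [map_sub, map_sum, evalAt_one]
  simp only [evalAt_bary, K.basis.sum_coord_apply_eq_one, sub_self]

theorem closedInterior_eq (K : Tri) :
    K.closedInterior = {x | ∀ i, 0 ≤ evalAt x (bary K i)} := by
  rw [← Affine.Simplex.convexHull_eq_closedInterior]
  have := K.basis.convexHull_eq_nonneg_coord
  simp only [evalAt_bary]
  exact this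

theorem interior_eq (K : Tri) : K.interior = {x | ∀ i, 0 < evalAt x (bary K i)} := by
  ext x
  have hx := K.basis.affineCombination_coord_eq_self x
  have h1 := K.basis.sum_coord_apply_eq_one x
  have h := Affine.Simplex.affineCombination_mem_interior_iff (s := K) h1
  have hx' : (Finset.affineCombination ℝ Finset.univ K.points) (fun i => K.basis.coord i x) = x := hx
  rw [hx'] at h
  rw [h]
  simp only [evalAt_bary, Set.mem_ofPred_eq, Set.mem_Ioo]
  -- The upper bounds by 1 follow from positivity of the other two coordinates, as the three sum to
  -- 1.
  refine ⟨fun h i => (h i).1, fun h i => ⟨h i, ?_⟩⟩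
  rw [Fin.sum_univ_three] at h1
  have a := h 0
  have b := h 1
  have c := h 2
  fin_cases i <;> simp <;> linarith

theorem interior_closedInterior (K : Tri) : interior K.closedInterior = K.interior := by
  rw [← Affine.Simplex.convexHull_eq_closedInterior, interior_eq]
  have := K.basis.interior_convexHull
  simp only [evalAt_bary]
  exact this

theorem isOpen_interior (K : Tri) : IsOpen K.interior := by
  rw [← interior_closedInterior]
  exact _root_.isOpen_interior

theorem interior_nonempty (K : Tri) : K.interior.Nonempty := by
  have h := K.basis.centroid_mem_interior_convexHull
  have e : convexHull ℝ (Set.range K.basis) = K.closedInterior :=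
    Affine.Simplex.convexHull_eq_closedInterior K
  rw [e, interior_closedInterior] at h
  exact ⟨_, h⟩

theorem volume_closedInterior_diff_interior (K : Tri) :
    volume (K.closedInterior \ K.interior) = 0 := by
  have h : Convex ℝ K.closedInterior := by
    rw [← Affine.Simplex.convexHull_eq_closedInterior]
    exact convex_convexHull ℝ _
  have h2 := h.addHaar_frontier volume
  rwa [K.isClosed_closedInterior.frontier_eq, interior_closedInterior] at h2

theorem volume_segment (x y : Pt) : volume (segment ℝ x y) = 0 := by
  have hs : segment ℝ x y ⊆ (affineSpan ℝ {x, y} : Set Pt) := by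
    rw [← convexHull_pair]
    exact convexHull_subset_affineSpan _
  refine measure_mono_null hs (Measure.addHaar_affineSubspace volume _ fun h => ?_)
  have h1 := (collinear_pair ℝ x y).finrank_le_one
  rw [← direction_affineSpan, h, AffineSubspace.direction_top, finrank_top] at h1
  simp at h1

/-! ### The bubble function -/

theorem pd_bary (K : Tri) (i : Fin 3) (l : Fin 2) : pd l (bary K i) =
    MvPolynomial.C ((K.basis.coord i).linear (EuclideanSpace.single l 1)) := by
  rw [bary, map_add, pd_C, zero_add, map_sum, Fin.sum_univ_two, pd_mul, pd_mul, pd_C, pd_C]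
  fin_cases l <;> simp [pd]

theorem bary_ne_zero (K : Tri) (i : Fin 3) : bary K i ≠ 0 := by
  intro h
  have := evalAt_bary_points K i i
  rw [h] at this
  simp at this

theorem exists_pd_bary_ne_zero (K : Tri) (i : Fin 3) : ∃ l, pd l (bary K i) ≠ 0 := by
  by_contra! h
  obtain ⟨c, hc⟩ := eq_C_of_pd_eq_zero h
  have h1 := evalAt_bary_points K i i
  have h2 := evalAt_bary_points K i (i + 1)
  rw [hc, evalAt_C] at h1 h2
  rw [if_pos rfl] at h1
  rw [if_neg (by fin_cases i <;> decide), h1] at h2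
  exact one_ne_zero h2

theorem totalDegree_bary (K : Tri) (i : Fin 3) : (bary K i).totalDegree = 1 := by
  apply le_antisymm
  · rw [bary]
    refine (MvPolynomial.totalDegree_add _ _).trans (max_le (by simp) ?_)
    refine (MvPolynomial.totalDegree_finsetSum _ _).trans (Finset.sup_le fun l _ => ?_)
    refine (MvPolynomial.totalDegree_mul _ _).trans ?_
    rw [MvPolynomial.totalDegree_C, MvPolynomial.totalDegree_X]
  · by_contra! h
    rw [Nat.lt_one_iff, MvPolynomial.totalDegree_eq_zero_iff_eq_C] at h
    obtain ⟨l, hl⟩ := exists_pd_bary_ne_zero K i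
    rw [h, pd_C] at hl
    exact hl rfl

/-- The cubic bubble function `λ₀ λ₁ λ₂` of `K`. -/
def bubble (K : Tri) : Poly := bary K 0 * bary K 1 * bary K 2

theorem bubble_eq (K : Tri) (i : Fin 3) :
    bubble K = bary K i * (bary K (i + 1) * bary K (i + 2)) := by
  fin_cases i <;> simp [bubble] <;> ring

theorem bubble_ne_zero (K : Tri) : bubble K ≠ 0 :=
  mul_ne_zero (mul_ne_zero (bary_ne_zero K 0) (bary_ne_zero K 1)) (bary_ne_zero K 2)

theorem totalDegree_bubble (K : Tri) : (bubble K).totalDegree = 3 := by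
  rw [bubble, MvPolynomial.totalDegree_mul_of_isDomain
      (mul_ne_zero (bary_ne_zero K 0) (bary_ne_zero K 1)) (bary_ne_zero K 2),
    MvPolynomial.totalDegree_mul_of_isDomain (bary_ne_zero K 0) (bary_ne_zero K 1)]
  simp [totalDegree_bary]

theorem totalDegree_bubble_sq (K : Tri) : (bubble K ^ 2).totalDegree = 6 := by
  rw [sq, MvPolynomial.totalDegree_mul_of_isDomain (bubble_ne_zero K) (bubble_ne_zero K),
    totalDegree_bubble]

/-- The points of the edge of `K` opposite to its `i`-th vertex. -/
def edgePt (K : Tri) (i : Fin 3) (t : ℝ) : Pt :=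
  K.points (i + 1) + t • (K.points (i + 2) - K.points (i + 1))

theorem edgePt_mem_segment (K : Tri) (i : Fin 3) {t : ℝ} (ht : t ∈ Set.Ioo (0 : ℝ) 1) :
    edgePt K i t ∈ segment ℝ (K.points (i + 1)) (K.points (i + 2)) := by
  rw [segment_eq_image']
  exact ⟨t, ⟨ht.1.le, ht.2.le⟩, rfl⟩

theorem evalAt_edgePt_self (K : Tri) (i : Fin 3) (t : ℝ) :
    evalAt (edgePt K i t) (bary K i) = 0 := by
  rw [edgePt, evalAt_bary_line, evalAt_bary_points, evalAt_bary_points]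
  fin_cases i <;> simp

theorem evalAt_edgePt_add_one (K : Tri) (i : Fin 3) (t : ℝ) :
    evalAt (edgePt K i t) (bary K (i + 1)) = 1 - t := by
  rw [edgePt, evalAt_bary_line, evalAt_bary_points, evalAt_bary_points]
  fin_cases i <;> simp

theorem evalAt_edgePt_add_two (K : Tri) (i : Fin 3) (t : ℝ) :
    evalAt (edgePt K i t) (bary K (i + 2)) = t := by
  rw [edgePt, evalAt_bary_line, evalAt_bary_points, evalAt_bary_points]
  fin_cases i <;> simp

/-- The line where λ_i = 0 is parametrised by λ_{i+2}, since λ_{i+1} is then determined by the sum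
being 1. -/
theorem eq_edgePt (K : Tri) (i : Fin 3) {x : Pt} (hx : evalAt x (bary K i) = 0) :
    x = edgePt K i (evalAt x (bary K (i + 2))) := by
  have h1 := congrArg (evalAt x) (sum_bary K)
  rw [map_sum, Fin.sum_univ_three, evalAt_one] at h1
  have hall : ∀ j, K.basis.coord j x =
      K.basis.coord j (edgePt K i (evalAt x (bary K (i + 2)))) := by
    intro j
    rw [← evalAt_bary, ← evalAt_bary]
    have h2 : j = i ∨ j = i + 1 ∨ j = i + 2 := by
      fin_cases i <;> fin_cases j <;> decide
    rcases h2 with rfl | rfl | rfl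
    · rw [hx, evalAt_edgePt_self]
    · rw [evalAt_edgePt_add_one]
      fin_cases i <;> simp at hx ⊢ <;> linarith
    · rw [evalAt_edgePt_add_two]
  exact K.basis.ext_elem hall

/-- Let σ be substitution of the projection x ↦ x - λ_i(x)d onto the line of the edge. Then σp = 0
because p vanishes on that line, while σ is the identity modulo λ_i. Hence p ≡ σp = 0 modulo λ_i. -/
theorem bary_dvd_of_edge (K : Tri) (i : Fin 3) {p : Poly}
    (h : ∀ t ∈ Set.Ioo (0 : ℝ) 1, evalAt (edgePt K i t) p = 0) : bary K i ∣ p := by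
  -- The linear part of λ_i takes the value 1 on `d`, so moving by -λ_i(x)d lands where λ_i = 0.
  let d : Pt := K.points i - K.points (i + 1)
  let σ : Poly →ₐ[ℝ] Poly :=
    MvPolynomial.aeval fun l => MvPolynomial.X l - MvPolynomial.C (d l) * bary K i
  have hσ : σ p = 0 := by
    refine eq_zero_of_evalAt_eq_zero_on_open isOpen_univ Set.univ_nonempty fun x _ => ?_
    have e : evalAt x (σ p) = evalAt (x - evalAt x (bary K i) • d) p := by
      simp only [σ, evalAt, AlgHom.toLinearMap_apply]
      rw [← AlgHom.comp_apply, MvPolynomial.comp_aeval]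
      congr 2
      funext l
      simp [mul_comm]
    rw [e]
    have hz : evalAt (x - evalAt x (bary K i) • d) (bary K i) = 0 := by
      have : x - evalAt x (bary K i) • d =
          x + evalAt x (bary K i) • (x - d - x) := by
        rw [sub_sub_cancel_left, smul_neg, sub_eq_add_neg]
      rw [this, evalAt_bary_line]
      have h3 : evalAt (x - d) (bary K i) = evalAt x (bary K i) - 1 := by
        have h4 : evalAt (x - d) (bary K i) = evalAt x (bary K i) -
            (evalAt (K.points i) (bary K i) - evalAt (K.points (i + 1)) (bary K i)) := by
          simp only [bary, map_add, evalAt_mul, evalAt_C, evalAt_X, Fin.sum_univ_two, d]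
          simp
          ring
        rw [h4, evalAt_bary_points, evalAt_bary_points, if_pos rfl,
          if_neg (by fin_cases i <;> decide), sub_zero]
      rw [h3]
      ring
    rw [eq_edgePt K i hz]
    exact evalAt_eq_zero_on_line h _
  have hmod : (Ideal.Quotient.mkₐ ℝ (Ideal.span {bary K i})).comp σ =
      Ideal.Quotient.mkₐ ℝ (Ideal.span {bary K i}) := by
    refine MvPolynomial.algHom_ext fun l => ?_
    simp only [AlgHom.comp_apply, σ, MvPolynomial.aeval_X, Ideal.Quotient.mkₐ_eq_mk]
    rw [Ideal.Quotient.eq, Ideal.mem_span_singleton]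
    exact ⟨-MvPolynomial.C (d l), by ring⟩
  have h1 := AlgHom.congr_fun hmod p
  rw [AlgHom.comp_apply, hσ, map_zero, Ideal.Quotient.mkₐ_eq_mk, eq_comm,
    Ideal.Quotient.eq_zero_iff_mem, Ideal.mem_span_singleton] at h1
  exact h1

/-- The three factors are peeled off one by one. On an open edge the other two coordinates are t and
1 - t, both nonzero, so the cofactor still vanishes there. -/
theorem bubble_dvd (K : Tri) {p : Poly}
    (h : ∀ i, ∀ t ∈ Set.Ioo (0 : ℝ) 1, evalAt (edgePt K i t) p = 0) : bubble K ∣ p := by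
  obtain ⟨q, rfl⟩ := bary_dvd_of_edge K 0 (h 0)
  have h1 : bary K 1 ∣ q := bary_dvd_of_edge K 1 fun t ht => by
    have := h 1 t ht
    have e := evalAt_edgePt_add_two K 1 t
    rw [show (1 + 2 : Fin 3) = 0 from rfl] at e
    rw [evalAt_mul, e] at this
    exact (mul_eq_zero.1 this).resolve_left ht.1.ne'
  obtain ⟨r, rfl⟩ := h1
  have h2 : bary K 2 ∣ r := bary_dvd_of_edge K 2 fun t ht => by
    have := h 2 t ht
    have e := evalAt_edgePt_add_two K 2 t
    have e' := evalAt_edgePt_add_one K 2 t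
    rw [show (2 + 2 : Fin 3) = 1 from rfl] at e
    rw [show (2 + 1 : Fin 3) = 0 from rfl] at e'
    rw [evalAt_mul, evalAt_mul, e, e'] at this
    have ht2 : 1 - t ≠ 0 := by have := ht.2; linarith
    exact (mul_eq_zero.1 ((mul_eq_zero.1 this).resolve_left ht2)).resolve_left ht.1.ne'
  obtain ⟨s, rfl⟩ := h2
  exact ⟨s, by rw [bubble]; ring⟩

theorem evalAt_edgePt_bubble (K : Tri) (i : Fin 3) (t : ℝ) :
    evalAt (edgePt K i t) (bubble K) = 0 := by
  rw [bubble_eq K i, evalAt_mul, evalAt_edgePt_self, zero_mul]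

/-- Write p = bq. On edge i only the term in which λ_i is differentiated survives, so ∂_l p = (∂_l
λ_i) λ_{i+1} λ_{i+2} q. Choosing l with ∂_l λ_i ≠ 0 shows that q vanishes on the open edge. -/
theorem bubble_sq_dvd (K : Tri) {p : Poly}
    (h : ∀ i, ∀ t ∈ Set.Ioo (0 : ℝ) 1, evalAt (edgePt K i t) p = 0)
    (h' : ∀ l, ∀ i, ∀ t ∈ Set.Ioo (0 : ℝ) 1, evalAt (edgePt K i t) (pd l p) = 0) :
    bubble K ^ 2 ∣ p := by
  obtain ⟨q, rfl⟩ := bubble_dvd K h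
  suffices hq : bubble K ∣ q by
    rw [sq]
    exact mul_dvd_mul_left _ hq
  refine bubble_dvd K fun i t ht => ?_
  obtain ⟨l, hl⟩ := exists_pd_bary_ne_zero K i
  have h1 := h' l i t ht
  rw [pd_mul, map_add, evalAt_mul, evalAt_mul, evalAt_edgePt_bubble, zero_mul, add_zero,
    bubble_eq K i, pd_mul, map_add, evalAt_mul, evalAt_mul _ (bary K i), evalAt_edgePt_self,
    zero_mul, add_zero, evalAt_mul, evalAt_edgePt_add_one, evalAt_edgePt_add_two, pd_bary, evalAt_C] at h1
  rw [pd_bary, Ne, MvPolynomial.C_eq_zero] at hl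
  have ht2 : 1 - t ≠ 0 := by have := ht.2; linarith
  exact (mul_eq_zero.1 h1).resolve_left (mul_ne_zero hl (mul_ne_zero ht2 ht.1.ne.symm))

/-! ### Order of vanishing at the vertices. -/

/-- The ideal of polynomials vanishing at `x`. -/
def pointIdeal (x : Pt) : Ideal Poly := RingHom.ker (MvPolynomial.aeval (R := ℝ) fun i => x i)

theorem mem_pointIdeal {x : Pt} {p : Poly} : p ∈ pointIdeal x ↔ evalAt x p = 0 := Iff.rfl

theorem pd_mem_pointIdeal_pow (x : Pt) (i : Fin 2) (m : ℕ) {p : Poly}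
    (hp : p ∈ pointIdeal x ^ (m + 1)) : pd i p ∈ pointIdeal x ^ m := by
  induction m generalizing p with
  | zero => simp
  | succ m ih =>
    rw [pow_succ] at hp
    refine Submodule.mul_induction_on hp (fun a ha b hb => ?_) (fun a b ha hb => ?_)
    · rw [pd_mul]
      refine add_mem ?_ (Ideal.mul_mem_right _ _ ha)
      rw [pow_succ]
      exact Ideal.mul_mem_mul (ih ha) hb
    · rw [map_add]
      exact add_mem ha hb

theorem pd_pow_mem_pointIdeal_pow (x : Pt) (i : Fin 2) (m j : ℕ) {p : Poly}
    (hp : p ∈ pointIdeal x ^ (m + j)) : (pd i ^ j) p ∈ pointIdeal x ^ m := by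
  induction j generalizing p with
  | zero => exact hp
  | succ j ih =>
    rw [pow_succ]
    exact ih (pd_mem_pointIdeal_pow x i _ hp)

/-- Each derivative lowers the power of the maximal ideal by at most one. Bubbles thereby meet the
vertex conditions with all jets zero. -/
theorem jet_eq_zero {x : Pt} {m : ℕ} {p : Poly} (hp : p ∈ pointIdeal x ^ (m + 1)) {i j : ℕ}
    (hij : i + j ≤ m) : evalAt x ((pd 0 ^ i) ((pd 1 ^ j) p)) = 0 := by
  rw [← mem_pointIdeal, ← pow_one (pointIdeal x)]
  refine pd_pow_mem_pointIdeal_pow x 0 1 i (pd_pow_mem_pointIdeal_pow x 1 _ j ?_)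
  exact Ideal.pow_le_pow_right (by omega) hp

/-- Two of the three barycentric factors vanish at each vertex. -/
theorem bubble_mem_pointIdeal (K : Tri) (i : Fin 3) : bubble K ∈ pointIdeal (K.points i) ^ 2 := by
  rw [bubble_eq K i]
  refine Ideal.mul_mem_left _ _ ?_
  rw [sq]
  refine Ideal.mul_mem_mul ?_ ?_ <;> rw [mem_pointIdeal, evalAt_bary_points] <;>
    exact if_neg (by fin_cases i <;> decide)

theorem bubble_mul_mem_pointIdeal (K : Tri) (i : Fin 3) (q : Poly) :
    bubble K * q ∈ pointIdeal (K.points i) ^ 2 :=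
  Ideal.mul_mem_right _ _ (bubble_mem_pointIdeal K i)

theorem bubble_sq_mul_mem_pointIdeal (K : Tri) (i : Fin 3) (q : Poly) :
    bubble K ^ 2 * q ∈ pointIdeal (K.points i) ^ 4 := by
  rw [pow_mul _ 2 2]
  exact Ideal.mul_mem_right _ _ (Ideal.pow_mem_pow (bubble_mem_pointIdeal K i) 2)

theorem evalAt_bubble_of_mem_segment (K : Tri) {i j : Fin 3} (hij : i ≠ j) {x : Pt}
    (hx : x ∈ segment ℝ (K.points i) (K.points j)) : evalAt x (bubble K) = 0 := by
  rw [segment_eq_image'] at hx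
  obtain ⟨t, -, rfl⟩ := hx
  obtain ⟨l, hi, hj⟩ : ∃ l : Fin 3, l ≠ i ∧ l ≠ j := by
    revert hij; revert i j; decide
  rw [bubble_eq K l, evalAt_mul, evalAt_bary_line, evalAt_bary_points, evalAt_bary_points,
    if_neg hi, if_neg hj]
  simp

theorem evalAt_bubble_pos (K : Tri) {x : Pt} (hx : x ∈ K.interior) : 0 < evalAt x (bubble K) := by
  rw [interior_eq] at hx
  rw [bubble, evalAt_mul, evalAt_mul]
  exact mul_pos (mul_pos (hx 0) (hx 1)) (hx 2)

theorem mem_interior_of_bubble_pos (K : Tri) {x : Pt} (hx : x ∈ K.closedInterior)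
    (hb : 0 < evalAt x (bubble K)) : x ∈ K.interior := by
  rw [closedInterior_eq] at hx
  rw [interior_eq]
  intro i
  refine lt_of_le_of_ne (hx i) fun h => ?_
  rw [bubble_eq K i, evalAt_mul, ← h, zero_mul] at hb
  exact lt_irrefl _ hb

/-! ### The divergence on one triangle -/

/-- With zero gradient on the edges, φ is constant along each of them, and the edges join every
vertex to vertex 0. -/
theorem edge_eq_zero_of_pd_eq_zero (K : Tri) {φ : Poly} (h0 : evalAt (K.points 0) φ = 0)
    (h : ∀ l, ∀ i, ∀ t ∈ Set.Ioo (0 : ℝ) 1, evalAt (edgePt K i t) (pd l φ) = 0) :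
    ∀ i, ∀ t ∈ Set.Ioo (0 : ℝ) 1, evalAt (edgePt K i t) φ = 0 := by
  have hall : ∀ l i t, evalAt (edgePt K i t) (pd l φ) = 0 := fun l i t =>
    evalAt_eq_zero_on_line (h l i) t
  have hconst : ∀ i s t, evalAt (edgePt K i s) φ = evalAt (edgePt K i t) φ := by
    intro i
    have hd : ∀ t, HasDerivAt (fun t => evalAt (edgePt K i t) φ) 0 t := by
      intro t
      have h1 : HasDerivAt (edgePt K i) (K.points (i + 2) - K.points (i + 1)) t := by
        have := ((hasDerivAt_id t).smul_const (K.points (i + 2) - K.points (i + 1))).const_add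
          (K.points (i + 1))
        rw [one_smul] at this
        exact this
      have h2 := (hasFDerivAt_evalAt φ (edgePt K i t)).comp_hasDerivAt t h1
      simp only [hall, zero_smul, Finset.sum_const_zero] at h2
      exact h2
    exact is_const_of_deriv_eq_zero (fun t => (hd t).differentiableAt) fun t => (hd t).deriv
  have e0 : ∀ i, edgePt K i 0 = K.points (i + 1) := fun i => by simp [edgePt]
  have e1 : ∀ i, edgePt K i 1 = K.points (i + 2) := fun i => by simp [edgePt]
  intro i t _
  have h1 : evalAt (K.points 1) φ = 0 := by
    rw [← h0]
    -- Edge 2 runs from vertex 0 to vertex 1, and edge 1 below from vertex 2 to vertex 0, with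
    -- indices modulo 3.
    have := hconst 2 1 0
    rw [e0, e1] at this
    exact this
  have h2 : evalAt (K.points 2) φ = 0 := by
    rw [← h0]
    have := hconst 1 0 1
    rw [e0, e1] at this
    exact this
  rw [hconst i t 0, e0]
  fin_cases i
  · exact h1
  · exact h2
  · exact h0

/-- A divergence-free field vanishing on the boundary of `K` is the curl of a polynomial that
vanishes there to second order. -/
theorem exists_stream_bubble (K : Tri) {m : ℕ} {p q : Poly} (hp : bubble K * p ∈ degLT m)
    (hq : bubble K * q ∈ degLT m) (h : pd 0 (bubble K * p) + pd 1 (bubble K * q) = 0) :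
    ∃ r, bubble K ^ 2 * r ∈ degLT (m + 1) ∧ pd 1 (bubble K ^ 2 * r) = bubble K * p ∧
      pd 0 (bubble K ^ 2 * r) = -(bubble K * q) := by
  obtain ⟨φ, hφ, h1, h2⟩ := exists_stream_poly hp hq h
  -- A stream function is determined up to a constant. Its gradient vanishes on ∂K, so normalising
  -- it at one vertex makes it vanish on all of ∂K.
  let ψ : Poly := φ - MvPolynomial.C (evalAt (K.points 0) φ)
  have hψ : ψ ∈ degLT (m + 1) := by
    refine sub_mem hφ ?_
    rw [mem_degLT_succ]
    simp
  have g : ∀ l, pd l ψ = pd l φ := fun l => by rw [map_sub, pd_C, sub_zero]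
  have hd : ∀ l, ∀ i, ∀ t ∈ Set.Ioo (0 : ℝ) 1, evalAt (edgePt K i t) (pd l ψ) = 0 := by
    intro l i t _
    rw [g]
    fin_cases l
    · simp [h2, evalAt_mul, evalAt_edgePt_bubble]
    · simp [h1, evalAt_mul, evalAt_edgePt_bubble]
  have h0 : evalAt (K.points 0) ψ = 0 := by simp [ψ, evalAt_C]
  obtain ⟨r, hr⟩ := bubble_sq_dvd K (edge_eq_zero_of_pd_eq_zero K h0 hd) hd
  exact ⟨r, hr ▸ hψ, by rw [← hr, g, h1], by rw [← hr, g, h2]⟩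

/-- Barycentric interpolation is exact on affine polynomials; it suffices to check 1 and the
coordinates. -/
theorem evalAt_eq_sum_bary (K : Tri) {p : Poly} (hp : p ∈ degLT 2) (x : Pt) :
    evalAt x p = ∑ i, evalAt (K.points i) p * evalAt x (bary K i) := by
  have h1 : ∀ x : Pt, ∑ i, evalAt x (bary K i) = 1 := fun x => by
    rw [← map_sum, sum_bary, evalAt_one]
  have hX : ∀ l, x l = ∑ i, K.points i l * evalAt x (bary K i) := by
    intro l
    have := K.basis.linear_combination_coord_eq_self x
    have := congrArg (fun y : Pt => y l) this
    simp only [← evalAt_bary] at this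
    rw [← this]
    simp only [WithLp.ofLp_sum, Finset.sum_apply, PiLp.smul_apply, smul_eq_mul]
    exact Finset.sum_congr rfl fun i _ => mul_comm _ _
  refine degLT_induction (C := fun p => evalAt x p =
    ∑ i, evalAt (K.points i) p * evalAt x (bary K i)) ?_ ?_ ?_ hp
  · simp
  · intro p q hp hq
    simp only [map_add, hp, hq, add_mul, Finset.sum_add_distrib]
  · intro s c hs
    have hcases : s = 0 ∨ ∃ l, s = Finsupp.single l 1 := by
      have h3 : (s 0 = 0 ∧ s 1 = 0) ∨ (s 0 = 1 ∧ s 1 = 0) ∨ (s 0 = 0 ∧ s 1 = 1) := by omega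
      rcases h3 with ⟨a, b⟩ | ⟨a, b⟩ | ⟨a, b⟩
      · left; ext l; fin_cases l <;> simp [a, b]
      · right; refine ⟨0, ?_⟩; ext l; fin_cases l <;> simp [a, b]
      · right; refine ⟨1, ?_⟩; ext l; fin_cases l <;> simp [a, b]
    rcases hcases with rfl | ⟨l, rfl⟩
    · have e : MvPolynomial.monomial 0 c = (MvPolynomial.C c : Poly) := rfl
      simp only [e, evalAt_C]
      rw [← Finset.mul_sum, h1, mul_one]
    · have e : MvPolynomial.monomial (Finsupp.single l 1) c =
          (MvPolynomial.C c * MvPolynomial.X l : Poly) := by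
        rw [MvPolynomial.C_mul_X_eq_monomial]
      simp only [e, evalAt_mul, evalAt_C, evalAt_X]
      rw [hX l, Finset.mul_sum]
      exact Finset.sum_congr rfl fun i _ => by ring

/-- The divergence of `bubble K • (a, b)`. -/
def divBubble (K : Tri) : Poly × Poly →ₗ[ℝ] Poly where
  toFun z := pd 0 (bubble K * z.1) + pd 1 (bubble K * z.2)
  map_add' y z := by
    simp only [Prod.fst_add, Prod.snd_add, mul_add, map_add]
    ring
  map_smul' c z := by
    simp only [Prod.smul_fst, Prod.smul_snd, mul_smul_comm, map_smul, RingHom.id_apply, smul_add]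

/-- The field `a` with `curl (bubble K ^ 2 * r) = bubble K • a`. -/
def curlBubble (K : Tri) : Poly →ₗ[ℝ] Poly × Poly where
  toFun r := (2 * pd 1 (bubble K) * r + bubble K * pd 1 r,
    -(2 * pd 0 (bubble K) * r + bubble K * pd 0 r))
  map_add' y z := by
    simp only [mul_add, map_add, Prod.mk_add_mk]
    congr 1 <;> ring
  map_smul' c z := by
    simp only [mul_smul_comm, map_smul, RingHom.id_apply, ← smul_add, ← smul_neg, Prod.smul_mk]

theorem pd_bubble_sq_mul (K : Tri) (l : Fin 2) (r : Poly) : pd l (bubble K ^ 2 * r) =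
    bubble K * (2 * pd l (bubble K) * r + bubble K * pd l r) := by
  rw [sq, pd_mul, pd_mul]
  ring

theorem evalAt_pd_of_mem_pointIdeal {x : Pt} {p : Poly} (hp : p ∈ pointIdeal x ^ 2) (l : Fin 2) :
    evalAt x (pd l p) = 0 := by
  rw [← mem_pointIdeal, ← pow_one (pointIdeal x)]
  exact pd_mem_pointIdeal_pow x l 1 hp

/-- On a triangle, a polynomial of degree less than `k` with zero mean that vanishes at the
vertices is the divergence of a field of degree at most `k` vanishing on the boundary. The mean is
represented by any linear form `L` with the properties used. -/
theorem exists_divBubble_eq (K : Tri) (L : Poly →ₗ[ℝ] ℝ) (hL : L (bary K 0 * bary K 1) ≠ 0)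
    (hdiv : ∀ l q, L (pd l (bubble K * q)) = 0) {k : ℕ} {q : Poly} (hq : q ∈ degLT k)
    (hv : ∀ i, evalAt (K.points i) q = 0) (hLq : L q = 0) :
    ∃ a b : Poly, bubble K * a ∈ degLT (k + 1) ∧ bubble K * b ∈ degLT (k + 1) ∧
      pd 0 (bubble K * a) + pd 1 (bubble K * b) = q := by
  -- Here q is affine and vanishes at three independent points, so it is zero. From k = 3 on there
  -- are nonzero bubble fields.
  by_cases hk : k ≤ 2
  · have hq0 : q = 0 := by
      have hq2 : q ∈ degLT 2 := mem_degLT_iff.2 fun s hs => (mem_degLT_iff.1 hq s hs).trans_le hk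
      refine eq_zero_of_evalAt_eq_zero_on_open isOpen_univ Set.univ_nonempty fun x _ => ?_
      rw [evalAt_eq_sum_bary K hq2 x]
      simp [hv]
    exact ⟨0, 0, by simp, by simp, by simp [hq0]⟩
  obtain ⟨m, rfl⟩ : ∃ m, k = m + 3 := ⟨k - 3, by omega⟩
  have hb := bubble_ne_zero K
  have hmem : ∀ p : Poly, bubble K * p ∈ degLT (m + 3 + 1) ↔ p ∈ degLT (m + 1) := fun p => by
    rw [show m + 3 + 1 = m + 1 + 3 by ring]
    exact mul_mem_degLT_iff hb (totalDegree_bubble K)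
  let D : degLT (m + 1) × degLT (m + 1) →ₗ[ℝ] degLT (m + 3) :=
    ((divBubble K).comp ((degLT (m + 1)).subtype.prodMap (degLT (m + 1)).subtype)).codRestrict _
      fun z => add_mem (pd_mem_degLT 0 ((hmem _).2 z.1.2)) (pd_mem_degLT 1 ((hmem _).2 z.2.2))
  have hD : ∀ z, (D z : Poly) = pd 0 (bubble K * z.1) + pd 1 (bubble K * z.2) := fun z => rfl
  -- The four constraints on the target: three vertex values and the mean. They are independent, so
  -- the kernel has codimension 4.
  let F : degLT (m + 3) →ₗ[ℝ] (Fin 3 → ℝ) × ℝ :=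
    ((LinearMap.pi fun i => evalAt (K.points i)).prod L).comp (degLT (m + 3)).subtype
  have hF : Function.Surjective F := by
    rintro ⟨w, c⟩
    -- The affine interpolant `u` takes the prescribed vertex values. The product λ₀λ₁ vanishes at
    -- all vertices and has nonzero `L`, so a multiple of it corrects the mean.
    let u : Poly := ∑ i, w i • bary K i
    let s : ℝ := (c - L u) / L (bary K 0 * bary K 1)
    have hu : u ∈ degLT (m + 3) := by
      refine sum_mem fun i _ => Submodule.smul_mem _ _ ?_
      rw [mem_degLT_succ, totalDegree_bary]
      omega
    have hs : s • (bary K 0 * bary K 1) ∈ degLT (m + 3) := by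
      refine Submodule.smul_mem _ _ ?_
      rw [mem_degLT_succ]
      refine (MvPolynomial.totalDegree_mul _ _).trans ?_
      rw [totalDegree_bary, totalDegree_bary]
      omega
    refine ⟨⟨u + s • (bary K 0 * bary K 1), add_mem hu hs⟩, ?_⟩
    refine Prod.ext ?_ ?_
    · funext j
      change evalAt (K.points j) (u + s • (bary K 0 * bary K 1)) = w j
      simp only [u, map_add, map_sum, map_smul, evalAt_mul, evalAt_bary_points]
      fin_cases j <;> simp
    · change L (u + s • (bary K 0 * bary K 1)) = c
      rw [map_add, map_smul, smul_eq_mul, div_mul_cancel₀ _ hL]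
      ring
  have hrange : LinearMap.range D ≤ LinearMap.ker F := by
    rintro _ ⟨z, rfl⟩
    rw [LinearMap.mem_ker]
    refine Prod.ext ?_ ?_
    · funext j
      change evalAt (K.points j) (pd 0 (bubble K * z.1) + pd 1 (bubble K * z.2)) = 0
      rw [map_add, evalAt_pd_of_mem_pointIdeal (bubble_mul_mem_pointIdeal K j _),
        evalAt_pd_of_mem_pointIdeal (bubble_mul_mem_pointIdeal K j _), add_zero]
    · change L (pd 0 (bubble K * z.1) + pd 1 (bubble K * z.2)) = 0
      rw [map_add, hdiv, hdiv, add_zero]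
  -- Every divergence-free bubble field is the curl of some b²r, and the degree of b²r is at most m
  -- + 4, so r lies in `degLT (m - 1)`.
  have hker : Module.finrank ℝ (LinearMap.ker D) ≤ Module.finrank ℝ (degLT (m - 1)) := by
    let ι := (degLT (m + 1)).subtype.prodMap (degLT (m + 1)).subtype
    have hι : Function.Injective ι :=
      Prod.map_injective.2 ⟨Subtype.val_injective, Subtype.val_injective⟩
    have hle : (LinearMap.ker D).map ι ≤
        LinearMap.range ((curlBubble K).comp (degLT (m - 1)).subtype) := by
      rintro _ ⟨z, hz, rfl⟩
      have hz0 : pd 0 (bubble K * z.1) + pd 1 (bubble K * z.2) = 0 := by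
        rw [← hD, LinearMap.mem_ker.1 hz]
        rfl
      obtain ⟨r, hr, h1, h2⟩ :=
        exists_stream_bubble K ((hmem _).2 z.1.2) ((hmem _).2 z.2.2) hz0
      have hr' : r ∈ degLT (m - 1) := by
        -- For m = 0 the degree of b²r would be below 6, which forces r = 0; this matches the
        -- truncated value m - 1 = 0.
        rcases Nat.eq_zero_or_pos m with rfl | hm
        · have : r = 0 := eq_zero_of_mul_mem_degLT hr (pow_ne_zero 2 hb)
            (by rw [totalDegree_bubble_sq]; norm_num)
          rw [this]
          exact zero_mem _
        · rw [show m + 3 + 1 + 1 = m - 1 + 6 by omega] at hr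
          exact (mul_mem_degLT_iff (pow_ne_zero 2 hb) (totalDegree_bubble_sq K)).1 hr
      refine ⟨⟨r, hr'⟩, ?_⟩
      rw [pd_bubble_sq_mul] at h1 h2
      refine Prod.ext ?_ ?_
      · exact mul_left_cancel₀ hb h1
      · rw [← mul_neg] at h2
        exact neg_eq_iff_eq_neg.2 (mul_left_cancel₀ hb h2)
    rw [(Submodule.equivMapOfInjective ι hι (LinearMap.ker D)).finrank_eq]
    exact (Submodule.finrank_mono hle).trans (LinearMap.finrank_range_le _)
  -- The range of D has dimension at least (m+1)(m+2) - m(m-1)/2. This equals (m+3)(m+4)/2 - 4, the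
  -- dimension of ker F, so the inclusion of the range in ker F is an equality.
  have h1 := LinearMap.finrank_range_add_finrank_ker D
  have h2 := LinearMap.finrank_range_add_finrank_ker F
  rw [LinearMap.range_eq_top.2 hF, finrank_top] at h2
  simp only [Module.finrank_prod, Module.finrank_fintype_fun_eq_card, Fintype.card_fin,
    Module.finrank_self] at h1 h2
  have d1 := two_mul_finrank_degLT (m + 1)
  have d3 := two_mul_finrank_degLT (m + 3)
  have d0 := two_mul_finrank_degLT (m - 1)
  have hle : Module.finrank ℝ (LinearMap.ker F) ≤ Module.finrank ℝ (LinearMap.range D) := by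
    rcases Nat.eq_zero_or_pos m with rfl | hm
    · omega
    · obtain ⟨j, rfl⟩ : ∃ j, m = j + 1 := ⟨m - 1, by omega⟩
      simp only [Nat.add_sub_cancel] at *
      generalize Module.finrank ℝ (degLT (j + 1 + 1)) = x1 at *
      generalize Module.finrank ℝ (degLT (j + 1 + 3)) = x3 at *
      nlinarith
  have heq := Submodule.eq_of_le_of_finrank_le hrange hle
  have hqF : (⟨q, hq⟩ : degLT (m + 3)) ∈ LinearMap.ker F := by
    rw [LinearMap.mem_ker]
    exact Prod.ext (funext hv) hLq
  rw [← heq] at hqF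
  obtain ⟨z, hz⟩ := hqF
  refine ⟨z.1, z.2, (hmem _).2 z.1.2, (hmem _).2 z.2.2, ?_⟩
  rw [← hD, hz]

open Filter Topology

/-! ### Closures of test functions -/

theorem IsTest.cpartial {Ω : Opens Pt} {φ : Pt → ℝ} (hφ : IsTest Ω φ) (i : Fin 2) :
    IsTest Ω (cpartial i φ) := by
  refine ⟨contDiff_cpartial i hφ.smooth, hasCompactSupport_cpartial i hφ.compact, ?_⟩
  refine Set.Subset.trans ?_ hφ.support
  refine (closure_mono ?_).trans (tsupport_fderiv_subset ℝ)
  intro x hx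
  rw [Function.mem_support] at hx ⊢
  intro h
  exact hx (by rw [StokesFE.cpartial, h]; rfl)

theorem IsTest.eq_zero_of_notMem {Ω : Opens Pt} {φ : Pt → ℝ} (hφ : IsTest Ω φ) {x : Pt}
    (hx : x ∉ Ω) : φ x = 0 :=
  image_eq_zero_of_notMem_tsupport fun h => hx (hφ.support h)

theorem IsTest.memLp {Ω : Opens Pt} {φ : Pt → ℝ} (hφ : IsTest Ω φ) :
    MemLp φ 2 (volume.restrict (Ω : Set Pt)) :=
  hφ.smooth.continuous.memLp_of_hasCompactSupport hφ.compact

/-- Integration by parts against a test function. -/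
theorem integral_mul_cpartial {Ω : Opens Pt} {f φ : Pt → ℝ} (hf : ContDiff ℝ ∞ f)
    (hφ : IsTest Ω φ) (i : Fin 2) :
    ∫ x in (Ω : Set Pt), f x * cpartial i φ x = -∫ x in (Ω : Set Pt), cpartial i f x * φ x := by
  have hs : ∀ g h : Pt → ℝ, IsTest Ω h →
      ∫ x in (Ω : Set Pt), g x * h x = ∫ x, g x * h x := by
    intro g h hh
    refine setIntegral_eq_integral_of_forall_compl_eq_zero fun x hx => ?_
    rw [hh.eq_zero_of_notMem hx, mul_zero]
  have hi : ∀ g h : Pt → ℝ, Continuous g → IsTest Ω h → Integrable fun x => g x * h x := by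
    intro g h hg hh
    exact (hg.mul hh.smooth.continuous).integrable_of_hasCompactSupport hh.compact.mul_left
  rw [hs _ _ (hφ.cpartial i), hs _ _ hφ]
  exact integral_mul_fderiv_eq_neg_fderiv_mul_of_integrable
    (hi _ _ (contDiff_cpartial i hf).continuous hφ)
    (hi _ _ hf.continuous (hφ.cpartial i)) (hi _ _ hf.continuous hφ)
    (fun x _ => (hf.differentiable (by simp)).differentiableAt)
    (fun x _ => (hφ.smooth.differentiable (by simp)).differentiableAt)

theorem continuous_integral_mul {Ω : Opens Pt} {φ : Pt → ℝ}
    (hφ : MemLp φ 2 (volume.restrict (Ω : Set Pt))) :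
    Continuous fun v : L2 Ω => ∫ x in (Ω : Set Pt), v x * φ x := by
  have h : (fun v : L2 Ω => ∫ x in (Ω : Set Pt), v x * φ x) =
      fun v : L2 Ω => inner ℝ (hφ.toLp φ) v := by
    funext v
    rw [L2.inner_def]
    refine integral_congr_ae ?_
    filter_upwards [hφ.coeFn_toLp] with x hx
    simp [hx]
  rw [h]
  exact continuous_const.inner continuous_id

/-- For fixed φ the defining identity is a closed condition on the pair, and it holds for test
functions by integration by parts. -/
theorem hasWeakPartial_of_mem_closure {Ω : Opens Pt} {z : L2 Ω × (Fin 2 → L2 Ω)}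
    (hz : z ∈ closure (testJet1 Ω : Set (L2 Ω × (Fin 2 → L2 Ω)))) (i : Fin 2) :
    HasWeakPartial Ω i z.1 (z.2 i) := by
  intro φ hφ
  have hc : IsClosed {z : L2 Ω × (Fin 2 → L2 Ω) | ∫ x in (Ω : Set Pt), z.1 x * cpartial i φ x =
      -∫ x in (Ω : Set Pt), z.2 i x * φ x} := by
    refine isClosed_eq ?_ ?_
    · exact (continuous_integral_mul (hφ.cpartial i).memLp).comp continuous_fst
    · exact ((continuous_integral_mul hφ.memLp).comp
        ((continuous_apply i).comp continuous_snd)).neg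
  refine closure_minimal ?_ hc hz
  rintro z ⟨ψ, hψ, h0, h1⟩
  have e0 : ∫ x in (Ω : Set Pt), z.1 x * cpartial i φ x =
      ∫ x in (Ω : Set Pt), ψ x * cpartial i φ x :=
    integral_congr_ae (h0.mono fun x hx => by simp only [hx])
  have e1 : ∫ x in (Ω : Set Pt), z.2 i x * φ x = ∫ x in (Ω : Set Pt), cpartial i ψ x * φ x :=
    integral_congr_ae ((h1 i).mono fun x hx => by simp only [hx])
  rw [Set.mem_ofPred_eq, e0, e1]
  exact integral_mul_cpartial hψ.smooth hφ i

theorem wpartial_of_mem_closure {Ω : Opens Pt} {z : L2 Ω × (Fin 2 → L2 Ω)}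
    (hz : z ∈ closure (testJet1 Ω : Set (L2 Ω × (Fin 2 → L2 Ω)))) (i : Fin 2) :
    wpartial i z.1 = z.2 i :=
  (hasWeakPartial_of_mem_closure hz i).wpartial_eq

theorem mem_H10_of_mem_closure {Ω : Opens Pt} {z : L2 Ω × (Fin 2 → L2 Ω)}
    (hz : z ∈ closure (testJet1 Ω : Set (L2 Ω × (Fin 2 → L2 Ω)))) : z.1 ∈ H10 Ω := by
  refine ⟨fun i => ⟨_, hasWeakPartial_of_mem_closure hz i⟩, ?_⟩
  simp only [wpartial_of_mem_closure hz]
  exact hz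

theorem fst_mem_closure_testJet1 {Ω : Opens Pt}
    {z : L2 Ω × (Fin 2 → L2 Ω) × (Fin 2 → Fin 2 → L2 Ω)}
    (hz : z ∈ closure (testJet2 Ω : Set (L2 Ω × (Fin 2 → L2 Ω) × (Fin 2 → Fin 2 → L2 Ω)))) :
    (z.1, z.2.1) ∈ closure (testJet1 Ω : Set (L2 Ω × (Fin 2 → L2 Ω))) := by
  refine map_mem_closure (f := fun z : L2 Ω × (Fin 2 → L2 Ω) × (Fin 2 → Fin 2 → L2 Ω) =>
    (z.1, z.2.1)) (by fun_prop) hz ?_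
  rintro y ⟨φ, hφ, h0, h1, -⟩
  exact ⟨φ, hφ, h0, h1⟩

theorem deriv_mem_closure_testJet1 {Ω : Opens Pt}
    {z : L2 Ω × (Fin 2 → L2 Ω) × (Fin 2 → Fin 2 → L2 Ω)}
    (hz : z ∈ closure (testJet2 Ω : Set (L2 Ω × (Fin 2 → L2 Ω) × (Fin 2 → Fin 2 → L2 Ω))))
    (j : Fin 2) :
    (z.2.1 j, fun i => z.2.2 i j) ∈ closure (testJet1 Ω : Set (L2 Ω × (Fin 2 → L2 Ω))) := by
  refine map_mem_closure (f := fun z : L2 Ω × (Fin 2 → L2 Ω) × (Fin 2 → Fin 2 → L2 Ω) =>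
    (z.2.1 j, fun i => z.2.2 i j)) (by fun_prop) hz ?_
  rintro y ⟨φ, hφ, -, h1, h2⟩
  exact ⟨cpartial j φ, hφ.cpartial j, h1 j, fun i => h2 i j⟩

theorem mem_H20_of_mem_closure {Ω : Opens Pt}
    {z : L2 Ω × (Fin 2 → L2 Ω) × (Fin 2 → Fin 2 → L2 Ω)}
    (hz : z ∈ closure (testJet2 Ω : Set (L2 Ω × (Fin 2 → L2 Ω) × (Fin 2 → Fin 2 → L2 Ω)))) :
    z.1 ∈ H20 Ω := by
  have h1 : ∀ i, wpartial i z.1 = z.2.1 i := wpartial_of_mem_closure (fst_mem_closure_testJet1 hz)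
  have h2 : ∀ i j, wpartial i (z.2.1 j) = z.2.2 i j := fun i j =>
    wpartial_of_mem_closure (deriv_mem_closure_testJet1 hz j) i
  refine ⟨⟨(mem_H10_of_mem_closure (fst_mem_closure_testJet1 hz)).1, fun j => ?_⟩, ?_⟩
  · rw [h1]
    exact (mem_H10_of_mem_closure (deriv_mem_closure_testJet1 hz j)).1
  · simp only [h1, h2]
    exact hz

/-- The derivative of a test function is a test function, and forgetting the other components of a
2-jet is continuous. -/
theorem wpartial_mem_H10 {Ω : Opens Pt} {v : L2 Ω} (hv : v ∈ H20 Ω) (j : Fin 2) :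
    wpartial j v ∈ H10 Ω :=
  mem_H10_of_mem_closure (deriv_mem_closure_testJet1 hv.2 j)

theorem integral_cpartial_eq_zero {Ω : Opens Pt} {φ : Pt → ℝ} (hφ : IsTest Ω φ) (i : Fin 2) :
    ∫ x in (Ω : Set Pt), cpartial i φ x = 0 := by
  have h := integral_mul_cpartial (f := fun _ => 1) contDiff_const hφ i
  simpa [cpartial] using h

/-- True for test functions, and a closed condition because 1 is in L² on a set of finite measure.
-/
theorem integral_wpartial_eq_zero {Ω : Opens Pt} [IsFiniteMeasure (volume.restrict (Ω : Set Pt))]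
    {v : L2 Ω} (hv : v ∈ H10 Ω) (i : Fin 2) : ∫ x in (Ω : Set Pt), wpartial i v x = 0 := by
  have hc : IsClosed {z : L2 Ω × (Fin 2 → L2 Ω) | ∫ x in (Ω : Set Pt), z.2 i x * 1 = 0} := by
    refine isClosed_eq ?_ continuous_const
    exact (continuous_integral_mul (φ := fun _ => 1) (memLp_const 1)).comp
      ((continuous_apply i).comp continuous_snd)
  have h : (v, fun i => wpartial i v) ∈
      {z : L2 Ω × (Fin 2 → L2 Ω) | ∫ x in (Ω : Set Pt), z.2 i x * 1 = 0} := by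
    refine closure_minimal ?_ hc hv.2
    rintro z ⟨ψ, hψ, -, h1⟩
    rw [Set.mem_ofPred_eq, ← integral_cpartial_eq_zero hψ i]
    exact integral_congr_ae ((h1 i).mono fun x hx => by simp only [hx, mul_one])
  simpa using h

/-! ### From bounded pointwise convergence to closures of jets. -/

/-- Uniformly bounded pointwise convergence. -/
structure BddTendsto (F : ℕ → Pt → ℝ) (F₀ : Pt → ℝ) : Prop where
  bdd : ∃ M, ∀ n x, |F n x| ≤ M
  tendsto : ∀ x, Tendsto (fun n => F n x) atTop (𝓝 (F₀ x))

theorem BddTendsto.add {F G : ℕ → Pt → ℝ} {F₀ G₀ : Pt → ℝ} (hF : BddTendsto F F₀)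
    (hG : BddTendsto G G₀) : BddTendsto (fun n => F n + G n) (F₀ + G₀) := by
  obtain ⟨M, hM⟩ := hF.bdd
  obtain ⟨N, hN⟩ := hG.bdd
  exact ⟨⟨M + N, fun n x => (abs_add_le _ _).trans (add_le_add (hM n x) (hN n x))⟩,
    fun x => (hF.tendsto x).add (hG.tendsto x)⟩

/-- Dominated convergence for the squared difference, with the constant bound (2M)². -/
theorem BddTendsto.tendsto_L2 {Ω : Opens Pt} [IsFiniteMeasure (volume.restrict (Ω : Set Pt))]
    {F : ℕ → Pt → ℝ} {F₀ : Pt → ℝ} (h : BddTendsto F F₀) {f : ℕ → L2 Ω} {f₀ : L2 Ω}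
    (hf : ∀ n, f n =ᵐ[volume.restrict (Ω : Set Pt)] F n)
    (hf₀ : f₀ =ᵐ[volume.restrict (Ω : Set Pt)] F₀) : Tendsto f atTop (𝓝 f₀) := by
  obtain ⟨M, hM⟩ := h.bdd
  have hM₀ : ∀ x, |F₀ x| ≤ M := fun x =>
    le_of_tendsto (h.tendsto x).abs (Eventually.of_forall fun n => hM n x)
  rw [tendsto_iff_norm_sub_tendsto_zero]
  have hsq : Tendsto (fun n => ‖f n - f₀‖ ^ 2) atTop (𝓝 0) := by
    have e : ∀ n, ‖f n - f₀‖ ^ 2 = ∫ x in (Ω : Set Pt), ((f n - f₀ : L2 Ω) x) ^ 2 := by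
      intro n
      rw [← real_inner_self_eq_norm_sq, L2.inner_def]
      refine integral_congr_ae (Eventually.of_forall fun x => ?_)
      simp [sq]
    simp only [e]
    have h0 : (0 : ℝ) = ∫ x in (Ω : Set Pt), (0 : ℝ) := by simp
    rw [h0]
    refine tendsto_integral_of_dominated_convergence (fun _ => (M + M) ^ 2) (fun n => ?_)
      (integrable_const _) (fun n => ?_) ?_
    · exact (Lp.aestronglyMeasurable _).pow 2
    · filter_upwards [Lp.coeFn_sub (f n) f₀, hf n, hf₀] with x h1 h2 h3
      rw [h1, Pi.sub_apply, h2, h3, norm_pow, Real.norm_eq_abs]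
      refine pow_le_pow_left₀ (abs_nonneg _) ?_ 2
      exact (abs_sub _ _).trans (add_le_add (hM n x) (hM₀ x))
    · have hall : ∀ᵐ x ∂(volume.restrict (Ω : Set Pt)), ∀ n, (f n - f₀ : L2 Ω) x = F n x - F₀ x := by
        rw [ae_all_iff]
        intro n
        filter_upwards [Lp.coeFn_sub (f n) f₀, hf n, hf₀] with x h1 h2 h3
        rw [h1, Pi.sub_apply, h2, h3]
      filter_upwards [hall] with x hx
      simp only [hx]
      have := ((h.tendsto x).sub_const (F₀ x)).pow 2
      simpa using this
  have := hsq.sqrt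
  simpa [Real.sqrt_sq (norm_nonneg _)] using this

theorem mem_closure_testJet1 {Ω : Opens Pt} [IsFiniteMeasure (volume.restrict (Ω : Set Pt))]
    {φ : ℕ → Pt → ℝ} (hφ : ∀ n, IsTest Ω (φ n)) {F : Pt → ℝ} {G : Fin 2 → Pt → ℝ}
    (h0 : BddTendsto φ F) (h1 : ∀ i, BddTendsto (fun n => cpartial i (φ n)) (G i))
    {z : L2 Ω × (Fin 2 → L2 Ω)} (hz : z.1 =ᵐ[volume.restrict (Ω : Set Pt)] F)
    (hz1 : ∀ i, z.2 i =ᵐ[volume.restrict (Ω : Set Pt)] G i) :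
    z ∈ closure (testJet1 Ω : Set (L2 Ω × (Fin 2 → L2 Ω))) := by
  refine mem_closure_of_tendsto (b := atTop)
    (f := fun n => ((hφ n).memLp.toLp _, fun i => ((hφ n).cpartial i).memLp.toLp _)) ?_
    (Eventually.of_forall fun n => ?_)
  · refine Tendsto.prodMk_nhds (x := z.1) (y := z.2) ?_ (tendsto_pi_nhds.2 fun i => ?_)
    · exact h0.tendsto_L2 (fun n => MemLp.coeFn_toLp _) hz
    · exact (h1 i).tendsto_L2 (fun n => MemLp.coeFn_toLp _) (hz1 i)
  · exact ⟨φ n, hφ n, (hφ n).memLp.coeFn_toLp, fun i => ((hφ n).cpartial i).memLp.coeFn_toLp⟩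

theorem mem_closure_testJet2 {Ω : Opens Pt} [IsFiniteMeasure (volume.restrict (Ω : Set Pt))]
    {φ : ℕ → Pt → ℝ} (hφ : ∀ n, IsTest Ω (φ n)) {F : Pt → ℝ} {G : Fin 2 → Pt → ℝ}
    {H : Fin 2 → Fin 2 → Pt → ℝ}
    (h0 : BddTendsto φ F) (h1 : ∀ i, BddTendsto (fun n => cpartial i (φ n)) (G i))
    (h2 : ∀ i j, BddTendsto (fun n => cpartial i (cpartial j (φ n))) (H i j))
    {z : L2 Ω × (Fin 2 → L2 Ω) × (Fin 2 → Fin 2 → L2 Ω)}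
    (hz : z.1 =ᵐ[volume.restrict (Ω : Set Pt)] F)
    (hz1 : ∀ i, z.2.1 i =ᵐ[volume.restrict (Ω : Set Pt)] G i)
    (hz2 : ∀ i j, z.2.2 i j =ᵐ[volume.restrict (Ω : Set Pt)] H i j) :
    z ∈ closure (testJet2 Ω : Set (L2 Ω × (Fin 2 → L2 Ω) × (Fin 2 → Fin 2 → L2 Ω))) := by
  refine mem_closure_of_tendsto (b := atTop)
    (f := fun n => ((hφ n).memLp.toLp _, (fun i => ((hφ n).cpartial i).memLp.toLp _),
      fun i j => (((hφ n).cpartial j).cpartial i).memLp.toLp _)) ?_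
    (Eventually.of_forall fun n => ?_)
  · refine Tendsto.prodMk_nhds (x := z.1) (y := z.2) ?_
      (Tendsto.prodMk_nhds (x := z.2.1) (y := z.2.2) (tendsto_pi_nhds.2 fun i => ?_)
        (tendsto_pi_nhds.2 fun i => tendsto_pi_nhds.2 fun j => ?_))
    · exact h0.tendsto_L2 (fun n => MemLp.coeFn_toLp _) hz
    · exact (h1 i).tendsto_L2 (fun n => MemLp.coeFn_toLp _) (hz1 i)
    · exact (h2 i j).tendsto_L2 (fun n => MemLp.coeFn_toLp _) (hz2 i j)
  · exact ⟨φ n, hφ n, (hφ n).memLp.coeFn_toLp, fun i => ((hφ n).cpartial i).memLp.coeFn_toLp,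
      fun i j => (((hφ n).cpartial j).cpartial i).memLp.coeFn_toLp⟩

/-! ### Bubble functions are limits of test functions -/

/-- Smooth functions on the line that vanish on `(-∞, 1)` and equal `c` on `(2, ∞)`. -/
structure IsCutoff (c : ℝ) (η : ℝ → ℝ) : Prop where
  smooth : ContDiff ℝ ∞ η
  eq_zero : ∀ s < 1, η s = 0
  eq_const : ∀ s > 2, η s = c

theorem exists_isCutoff : ∃ η, IsCutoff 1 η :=
  ⟨fun s => Real.smoothTransition (s - 1),
    (Real.smoothTransition.contDiff (n := ⊤)).comp (contDiff_id.sub contDiff_const),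
    fun s hs => Real.smoothTransition.zero_of_nonpos (by linarith),
    fun s hs => Real.smoothTransition.one_of_one_le (by linarith)⟩

/-- Differentiating η(Nb) gives Nη'(Nb)∂b. With a further factor b this is s η'(s) at s = Nb, times
∂b. That function of s is again a cutoff, now with limit 0, so the term is bounded uniformly in N
and disappears in the limit. -/
theorem IsCutoff.mul_deriv {c : ℝ} {η : ℝ → ℝ} (h : IsCutoff c η) :
    IsCutoff 0 (fun s => s * deriv η s) := by
  refine ⟨contDiff_id.mul (contDiff_infty_iff_deriv.1 h.smooth).2, fun s hs => ?_, fun s hs => ?_⟩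
  · have : η =ᶠ[𝓝 s] fun _ => 0 := by
      filter_upwards [Iio_mem_nhds hs] with t ht using h.eq_zero t ht
    rw [this.deriv_eq]
    simp
  · have : η =ᶠ[𝓝 s] fun _ => c := by
      filter_upwards [Ioi_mem_nhds hs] with t ht using h.eq_const t ht
    rw [this.deriv_eq]
    simp

theorem IsCutoff.bdd {c : ℝ} {η : ℝ → ℝ} (h : IsCutoff c η) : ∃ M, ∀ s, |η s| ≤ M := by
  obtain ⟨M, hM⟩ := (isCompact_Icc (a := (1 : ℝ)) (b := 2)).exists_bound_of_continuousOn
    h.smooth.continuous.continuousOn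
  refine ⟨max M |c|, fun s => ?_⟩
  rcases lt_or_ge s 1 with h1 | h1
  · rw [h.eq_zero s h1, abs_zero]
    exact le_max_of_le_right (abs_nonneg c)
  · rcases lt_or_ge 2 s with h2 | h2
    · rw [h.eq_const s h2]
      exact le_max_right _ _
    · exact le_max_of_le_left (hM s ⟨h1, h2⟩)

/-- The polynomial `r` on `K`, cut off near the boundary, and zero outside `K`. -/
def cut (K : Tri) (η : ℝ → ℝ) (N : ℝ) (r : Poly) : Pt → ℝ :=
  K.interior.indicator fun x => η (N * evalAt x (bubble K)) * evalAt x r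

theorem contDiff_cut_aux (K : Tri) {c : ℝ} {η : ℝ → ℝ} (hη : IsCutoff c η) (N : ℝ) (r : Poly) :
    ContDiff ℝ ∞ fun x => η (N * evalAt x (bubble K)) * evalAt x r :=
  (hη.smooth.comp (contDiff_const.mul (contDiff_evalAt _))).mul (contDiff_evalAt r)

theorem isCompact_cutSet (K : Tri) (N : ℝ) :
    IsCompact (K.closedInterior ∩ {x | 1 ≤ N * evalAt x (bubble K)}) :=
  K.isCompact_closedInterior.inter_right
    (isClosed_le continuous_const (continuous_const.mul (continuous_evalAt _)))

theorem cutSet_subset (K : Tri) {N : ℝ} (hN : 0 < N) :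
    K.closedInterior ∩ {x | 1 ≤ N * evalAt x (bubble K)} ⊆ K.interior := by
  rintro x ⟨hx, h⟩
  refine mem_interior_of_bubble_pos K hx ?_
  have h1 : 0 < N * evalAt x (bubble K) := lt_of_lt_of_le zero_lt_one h
  exact (pos_iff_pos_of_mul_pos h1).1 hN

theorem cut_eq_zero (K : Tri) {c : ℝ} {η : ℝ → ℝ} (hη : IsCutoff c η) {N : ℝ} (r : Poly)
    {x : Pt} (hx : x ∉ K.closedInterior ∩ {x | 1 ≤ N * evalAt x (bubble K)}) :
    cut K η N r x = 0 := by
  by_cases hxK : x ∈ K.interior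
  · rw [cut, Set.indicator_of_mem hxK, hη.eq_zero, zero_mul]
    by_contra! h
    exact hx ⟨K.interior_subset_closedInterior hxK, h⟩
  · exact Set.indicator_of_notMem hxK _

theorem cut_eventuallyEq (K : Tri) (η : ℝ → ℝ) (N : ℝ) (r : Poly) {x : Pt} (hx : x ∈ K.interior) :
    cut K η N r =ᶠ[𝓝 x] fun x => η (N * evalAt x (bubble K)) * evalAt x r := by
  filter_upwards [(isOpen_interior K).mem_nhds hx] with y hy
  exact Set.indicator_of_mem hy _

theorem cut_eventuallyEq_zero (K : Tri) {c : ℝ} {η : ℝ → ℝ} (hη : IsCutoff c η) {N : ℝ}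
    (hN : 0 < N) (r : Poly) {x : Pt} (hx : x ∉ K.interior) : cut K η N r =ᶠ[𝓝 x] fun _ => 0 := by
  filter_upwards [(isCompact_cutSet K N).isClosed.isOpen_compl.mem_nhds
    fun h => hx (cutSet_subset K hN h)] with y hy
  exact cut_eq_zero K hη r hy

/-- The support lies where Nb ≥ 1, a compact subset of the open triangle, so extension by zero is
smooth. -/
theorem isTest_cut {Ω : Opens Pt} (K : Tri) (hK : K.interior ⊆ (Ω : Set Pt)) {c : ℝ} {η : ℝ → ℝ}
    (hη : IsCutoff c η) {N : ℝ} (hN : 0 < N) (r : Poly) : IsTest Ω (cut K η N r) := by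
  have hsupp : tsupport (cut K η N r) ⊆
      K.closedInterior ∩ {x | 1 ≤ N * evalAt x (bubble K)} := by
    refine closure_minimal (fun x hx => ?_) (isCompact_cutSet K N).isClosed
    by_contra h
    exact hx (cut_eq_zero K hη r h)
  refine ⟨?_, (isCompact_cutSet K N).of_isClosed_subset (isClosed_tsupport _) hsupp,
    (hsupp.trans (cutSet_subset K hN)).trans hK⟩
  rw [contDiff_iff_contDiffAt]
  intro x
  by_cases hx : x ∈ K.interior
  · exact (contDiff_cut_aux K hη N r).contDiffAt.congr_of_eventuallyEq (cut_eventuallyEq K η N r hx)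
  · exact contDiffAt_const.congr_of_eventuallyEq (cut_eventuallyEq_zero K hη hN r hx)

/-- The factor b of the argument absorbs the N from the chain rule, so both terms are again cut
polynomials. -/
theorem cpartial_cut (K : Tri) {c : ℝ} {η : ℝ → ℝ} (hη : IsCutoff c η) {N : ℝ} (hN : 0 < N)
    (i : Fin 2) (r : Poly) : cpartial i (cut K η N (bubble K * r)) =
      cut K (fun s => s * deriv η s) N (pd i (bubble K) * r) +
        cut K η N (pd i (bubble K * r)) := by
  funext x
  by_cases hx : x ∈ K.interior
  · rw [Pi.add_apply, cpartial, (cut_eventuallyEq K η N _ hx).fderiv_eq, cut, cut,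
      Set.indicator_of_mem hx, Set.indicator_of_mem hx]
    have hb := (hasFDerivAt_evalAt (bubble K) x).const_mul N
    have he : HasDerivAt η (deriv η (N * evalAt x (bubble K))) (N * evalAt x (bubble K)) :=
      ((hη.smooth.differentiable (by simp)).differentiableAt).hasDerivAt
    have h := (he.comp_hasFDerivAt x hb).mul (hasFDerivAt_evalAt (bubble K * r) x)
    have h' := h.fderiv
    simp only [Function.comp_def] at h'
    erw [h']
    fin_cases i <;> simp [Fin.sum_univ_two, evalAt_mul] <;> ring
  · rw [Pi.add_apply, cpartial, (cut_eventuallyEq_zero K hη hN _ hx).fderiv_eq, cut, cut,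
      Set.indicator_of_notMem hx, Set.indicator_of_notMem hx]
    simp

theorem bddTendsto_cut (K : Tri) {c : ℝ} {η : ℝ → ℝ} (hη : IsCutoff c η) (r : Poly) :
    BddTendsto (fun n : ℕ => cut K η (n + 1) r)
      (K.interior.indicator fun x => evalAt x (c • r)) := by
  constructor
  · obtain ⟨M, hM⟩ := hη.bdd
    obtain ⟨M', hM'⟩ := K.isCompact_closedInterior.exists_bound_of_continuousOn
      (continuous_evalAt r).continuousOn
    have hM0 : 0 ≤ M := (abs_nonneg _).trans (hM 0)
    refine ⟨M * M', fun n x => ?_⟩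
    have hM0' : 0 ≤ M' := (norm_nonneg _).trans (hM' _ (K.point_mem_closedInterior 0))
    by_cases hx : x ∈ K.interior
    · rw [cut, Set.indicator_of_mem hx, abs_mul]
      exact mul_le_mul (hM _) (hM' x (K.interior_subset_closedInterior hx)) (abs_nonneg _) hM0
    · rw [cut, Set.indicator_of_notMem hx, abs_zero]
      positivity
  · intro x
    by_cases hx : x ∈ K.interior
    · have hb := evalAt_bubble_pos K hx
      have ht : Tendsto (fun n : ℕ => ((n : ℝ) + 1) * evalAt x (bubble K)) atTop atTop :=
        (tendsto_atTop_add_const_right _ 1 tendsto_natCast_atTop_atTop).atTop_mul_const hb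
      -- Since b(x) > 0, eventually Nb(x) > 2 and the cutoff equals `c` exactly.
      refine tendsto_const_nhds.congr' ?_
      filter_upwards [ht.eventually_gt_atTop 2] with n hn
      rw [cut, Set.indicator_of_mem hx, Set.indicator_of_mem hx, hη.eq_const _ hn, map_smul,
        smul_eq_mul]
    · simp only [cut, Set.indicator_of_notMem hx]
      exact tendsto_const_nhds

theorem memLp_indicator_evalAt (Ω : Opens Pt) (K : Tri) (p : Poly) :
    MemLp (K.interior.indicator fun x => evalAt x p) 2 (volume.restrict (Ω : Set Pt)) := by
  obtain ⟨M, hM⟩ := K.isCompact_closedInterior.exists_bound_of_continuousOn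
    (continuous_evalAt p).continuousOn
  have hm : MeasurableSet K.interior := (isOpen_interior K).measurableSet
  rw [memLp_indicator_iff_restrict hm]
  have : IsFiniteMeasure ((volume.restrict (Ω : Set Pt)).restrict K.interior) := by
    refine ⟨?_⟩
    rw [Measure.restrict_apply_univ]
    exact (Measure.restrict_apply_le _ _).trans_lt ((measure_mono K.interior_subset_closedInterior).trans_lt
      K.isCompact_closedInterior.measure_lt_top)
  refine MemLp.of_bound (continuous_evalAt p).aestronglyMeasurable M ?_
  filter_upwards [ae_restrict_mem hm] with x hx
  exact hM x (K.interior_subset_closedInterior hx)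

/-- The function in `L²(Ω)` that is `p` on `K` and zero elsewhere. -/
def pieceL2 (Ω : Opens Pt) (K : Tri) : Poly →ₗ[ℝ] L2 Ω where
  toFun p := (memLp_indicator_evalAt Ω K p).toLp _
  map_add' p q := by
    rw [← MemLp.toLp_add]
    congr 1
    funext x
    by_cases hx : x ∈ K.interior <;> simp [hx]
  map_smul' c p := by
    rw [RingHom.id_apply, ← MemLp.toLp_const_smul]
    congr 1
    funext x
    by_cases hx : x ∈ K.interior <;> simp [hx]

theorem coeFn_pieceL2 (Ω : Opens Pt) (K : Tri) (p : Poly) :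
    pieceL2 Ω K p =ᵐ[volume.restrict (Ω : Set Pt)] K.interior.indicator fun x => evalAt x p :=
  (memLp_indicator_evalAt Ω K p).coeFn_toLp

section Closure

variable {Ω : Opens Pt} [IsFiniteMeasure (volume.restrict (Ω : Set Pt))] {K : Tri}

theorem pieceL2_bubble_mem_closure (hK : K.interior ⊆ (Ω : Set Pt)) (q : Poly) :
    (pieceL2 Ω K (bubble K * q), fun i => pieceL2 Ω K (pd i (bubble K * q))) ∈
      closure (testJet1 Ω : Set (L2 Ω × (Fin 2 → L2 Ω))) := by
  obtain ⟨η, hη⟩ := exists_isCutoff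
  have hN : ∀ n : ℕ, (0 : ℝ) < n + 1 := fun n => by positivity
  refine mem_closure_testJet1 (fun n => isTest_cut K hK hη (hN n) (bubble K * q))
    (bddTendsto_cut K hη _) (fun i => ?_) ?_ (fun i => ?_)
    -- The first summand is the zero limit of the terms where the derivative falls on the cutoff.
    (G := fun i => (K.interior.indicator fun x => evalAt x ((0 : ℝ) • (pd i (bubble K) * q))) +
      K.interior.indicator fun x => evalAt x ((1 : ℝ) • pd i (bubble K * q)))
  · simp only [cpartial_cut K hη (hN _)]
    exact (bddTendsto_cut K hη.mul_deriv _).add (bddTendsto_cut K hη _)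
  · simp only [one_smul]
    exact coeFn_pieceL2 Ω K _
  · simp only [zero_smul, one_smul, map_zero, Set.indicator_zero]
    refine (coeFn_pieceL2 Ω K _).trans (Eventually.of_forall fun x => ?_)
    simp

theorem pieceL2_bubble_sq_mem_closure (hK : K.interior ⊆ (Ω : Set Pt)) (q : Poly) :
    (pieceL2 Ω K (bubble K ^ 2 * q), (fun i => pieceL2 Ω K (pd i (bubble K ^ 2 * q))),
      fun i j => pieceL2 Ω K (pd i (pd j (bubble K ^ 2 * q)))) ∈
      closure (testJet2 Ω : Set (L2 Ω × (Fin 2 → L2 Ω) × (Fin 2 → Fin 2 → L2 Ω))) := by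
  obtain ⟨η, hη⟩ := exists_isCutoff
  have hN : ∀ n : ℕ, (0 : ℝ) < n + 1 := fun n => by positivity
  -- `s j` is the cofactor in ∂_j(b²q) = b · s j. Each differentiation uses up one factor b, and b²
  -- supplies enough for two.
  let s : Fin 2 → Poly := fun j => 2 * pd j (bubble K) * q + bubble K * pd j q
  have e0 : bubble K ^ 2 * q = bubble K * (bubble K * q) := by ring
  have e1 : ∀ j, pd j (bubble K * (bubble K * q)) = bubble K * s j := fun j => by
    rw [← e0, pd_bubble_sq_mul]
  have e2 : ∀ j, pd j (bubble K) * (bubble K * q) = bubble K * (pd j (bubble K) * q) := fun j => by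
    ring
  have h1 : ∀ (n : ℕ) j, cpartial j (cut K η (n + 1) (bubble K ^ 2 * q)) =
      cut K (fun s => s * deriv η s) (n + 1) (bubble K * (pd j (bubble K) * q)) +
        cut K η (n + 1) (bubble K * s j) := fun n j => by
    rw [e0, cpartial_cut K hη (hN n), e1, e2]
  have h2 : ∀ (n : ℕ) i j, cpartial i (cpartial j (cut K η (n + 1) (bubble K ^ 2 * q))) =
      (cut K (fun s => s * deriv (fun s => s * deriv η s) s) (n + 1)
          (pd i (bubble K) * (pd j (bubble K) * q)) +
        cut K (fun s => s * deriv η s) (n + 1) (pd i (bubble K * (pd j (bubble K) * q)))) +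
      (cut K (fun s => s * deriv η s) (n + 1) (pd i (bubble K) * s j) +
        cut K η (n + 1) (pd i (bubble K * s j))) := fun n i j => by
    rw [h1, cpartial_add i (isTest_cut (Ω := Ω) K hK hη.mul_deriv (hN n) _).smooth
      (isTest_cut (Ω := Ω) K hK hη (hN n) _).smooth, cpartial_cut K hη.mul_deriv (hN n),
      cpartial_cut K hη (hN n)]
  have hb := fun r => bddTendsto_cut K hη r
  have hb' := fun r => bddTendsto_cut K hη.mul_deriv r
  have hb'' := fun r => bddTendsto_cut K hη.mul_deriv.mul_deriv r
  simp only [one_smul, zero_smul, map_zero] at hb hb' hb''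
  refine mem_closure_testJet2 (fun n => isTest_cut K hK hη (hN n) (bubble K ^ 2 * q))
    (hb _) (fun i => ?_) (fun i j => ?_) (coeFn_pieceL2 Ω K _)
    (fun i => (coeFn_pieceL2 Ω K _)) (fun i j => (coeFn_pieceL2 Ω K _))
  · simp only [h1]
    convert (hb' (bubble K * (pd i (bubble K) * q))).add (hb (bubble K * s i)) using 1
    rw [e0, e1]
    funext x
    simp
  · simp only [h2]
    convert ((hb'' (pd i (bubble K) * (pd j (bubble K) * q))).add
      (hb' (pd i (bubble K * (pd j (bubble K) * q))))).add
      ((hb' (pd i (bubble K) * s j)).add (hb (pd i (bubble K * s j)))) using 1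
    rw [e0, e1]
    funext x
    simp

theorem pieceL2_bubble_mem_H10 (hK : K.interior ⊆ (Ω : Set Pt)) (q : Poly) :
    pieceL2 Ω K (bubble K * q) ∈ H10 Ω :=
  mem_H10_of_mem_closure (pieceL2_bubble_mem_closure hK q)

theorem wpartial_pieceL2_bubble (hK : K.interior ⊆ (Ω : Set Pt)) (q : Poly)
    (i : Fin 2) :
    wpartial i (pieceL2 Ω K (bubble K * q)) = pieceL2 Ω K (pd i (bubble K * q)) :=
  wpartial_of_mem_closure (pieceL2_bubble_mem_closure hK q) i

theorem pieceL2_bubble_sq_mem_H20 (hK : K.interior ⊆ (Ω : Set Pt)) (q : Poly) :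
    pieceL2 Ω K (bubble K ^ 2 * q) ∈ H20 Ω :=
  mem_H20_of_mem_closure (pieceL2_bubble_sq_mem_closure hK q)

end Closure

/-! ### The mean over a triangle. -/

/-- The integral of a polynomial over a triangle. -/
def integralTri (K : Tri) : Poly →ₗ[ℝ] ℝ where
  toFun p := ∫ x in K.closedInterior, evalAt x p
  map_add' p q := by
    simp only [map_add]
    exact integral_add ((continuous_evalAt p).continuousOn.integrableOn_compact
      K.isCompact_closedInterior) ((continuous_evalAt q).continuousOn.integrableOn_compact
      K.isCompact_closedInterior)
  map_smul' c p := by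
    simp only [map_smul, RingHom.id_apply]
    exact integral_smul _ _

theorem interior_ae_eq_closedInterior (K : Tri) :
    K.interior =ᵐ[volume] K.closedInterior := by
  refine (LE.le.eventuallyLE K.interior_subset_closedInterior).antisymm ?_
  exact ae_le_set.2 (volume_closedInterior_diff_interior K)

/-- The divergence theorem in weak form: on the open triangle taken as the domain, bq is in H¹₀, so
its derivatives have mean zero. -/
theorem integralTri_pd_bubble (K : Tri) (l : Fin 2) (q : Poly) :
    integralTri K (pd l (bubble K * q)) = 0 := by
  let Ω : Opens Pt := ⟨K.interior, isOpen_interior K⟩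
  have hfin : IsFiniteMeasure (volume.restrict (Ω : Set Pt)) := ⟨by
    rw [Measure.restrict_apply_univ]
    exact (measure_mono K.interior_subset_closedInterior).trans_lt
      K.isCompact_closedInterior.measure_lt_top⟩
  have hK : K.interior ⊆ (Ω : Set Pt) := subset_rfl
  have h := integral_wpartial_eq_zero (pieceL2_bubble_mem_H10 hK q) l
  rw [wpartial_pieceL2_bubble hK, integral_congr_ae (coeFn_pieceL2 Ω K _)] at h
  change ∫ x in K.closedInterior, evalAt x (pd l (bubble K * q)) = 0
  rw [← setIntegral_congr_set (interior_ae_eq_closedInterior K), ← h]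
  refine setIntegral_congr_fun (isOpen_interior K).measurableSet fun x hx => ?_
  exact (Set.indicator_of_mem (s := K.interior) hx fun x => evalAt x (pd l (bubble K * q))).symm

theorem integralTri_bary_mul_bary_ne_zero (K : Tri) :
    integralTri K (bary K 0 * bary K 1) ≠ 0 := by
  have hpos : 0 < ∫ x in K.interior, evalAt x (bary K 0 * bary K 1) := by
    rw [setIntegral_pos_iff_support_of_nonneg_ae]
    · have : K.interior ⊆ Function.support (fun x => evalAt x (bary K 0 * bary K 1)) ∩ K.interior := by
        intro x hx
        refine ⟨?_, hx⟩
        rw [interior_eq] at hx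
        rw [Function.mem_support, evalAt_mul]
        exact (mul_pos (hx 0) (hx 1)).ne'
      exact ((isOpen_interior K).measure_pos volume (interior_nonempty K)).trans_le
        (measure_mono this)
    · filter_upwards [ae_restrict_mem (isOpen_interior K).measurableSet] with x hx
      rw [interior_eq] at hx
      rw [evalAt_mul]
      exact (mul_pos (hx 0) (hx 1)).le
    · exact ((continuous_evalAt _).continuousOn.integrableOn_compact
        K.isCompact_closedInterior).mono_set K.interior_subset_closedInterior
  change ∫ x in K.closedInterior, evalAt x (bary K 0 * bary K 1) ≠ 0
  rw [← setIntegral_congr_set (interior_ae_eq_closedInterior K)]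
  exact hpos.ne.symm

/-! ### Pieces of functions on a mesh -/

theorem HasPiece.unique {Ω : Opens Pt} {K : Tri} (hK : K.interior ⊆ (Ω : Set Pt)) {v : L2 Ω}
    {p q : Poly} (hp : HasPiece Ω K v p) (hq : HasPiece Ω K v q) : p = q := by
  rw [← sub_eq_zero]
  refine eq_zero_of_evalAt_eq_zero_on_open (isOpen_interior K) (interior_nonempty K) ?_
  have hae : ∀ᵐ x ∂(volume.restrict K.interior), evalAt x (p - q) = 0 := by
    have h1 := ae_mono (Measure.restrict_mono_set volume hK) (hp.and hq)
    filter_upwards [h1, ae_restrict_mem (isOpen_interior K).measurableSet] with x hx hm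
    have hm' := K.interior_subset_closedInterior hm
    rw [map_sub, ← hx.1 hm', ← hx.2 hm', sub_self]
  exact fun x hx => Measure.eqOn_open_of_ae_eq hae (isOpen_interior K)
    (continuous_evalAt _).continuousOn continuousOn_const hx

/-- Test functions supported in the open triangle see only the polynomial, so there the weak
derivative is the formal one. The boundary of the triangle is null. -/
theorem HasPiece.wpartial {Ω : Opens Pt} {K : Tri} (hK : K.interior ⊆ (Ω : Set Pt)) {v w : L2 Ω}
    {p : Poly} {i : Fin 2} (hp : HasPiece Ω K v p) (hw : HasWeakPartial Ω i v w) :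
    HasPiece Ω K w (pd i p) := by
  have hloc : LocallyIntegrableOn (fun x => w x - evalAt x (pd i p)) K.interior
      (volume.restrict (Ω : Set Pt)) := by
    have h1 := ((Lp.memLp w).locallyIntegrable (by norm_num)).locallyIntegrableOn K.interior
    have h2 : LocallyIntegrable (fun x => evalAt x (pd i p)) (volume.restrict (Ω : Set Pt)) :=
      (continuous_evalAt _).locallyIntegrable
    exact h1.sub (h2.locallyIntegrableOn _)
  have key := (isOpen_interior K).ae_eq_zero_of_integral_contDiff_smul_eq_zero hloc (by
    intro g g1 g2 g3
    have hg : IsTest Ω g := ⟨g1, g2, g3.trans hK⟩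
    have hgK : IsTest ⟨K.interior, isOpen_interior K⟩ g := ⟨g1, g2, g3⟩
    have e1 : ∫ x in (Ω : Set Pt), v x * cpartial i g x =
        ∫ x in (Ω : Set Pt), evalAt x p * cpartial i g x := by
      refine integral_congr_ae ?_
      filter_upwards [hp] with x hx
      by_cases hm : x ∈ K.interior
      · rw [hx (K.interior_subset_closedInterior hm)]
      · rw [(hgK.cpartial i).eq_zero_of_notMem hm, mul_zero, mul_zero]
    have e2 := integral_mul_cpartial (contDiff_evalAt p) hg i
    rw [cpartial_evalAt] at e2
    have e3 := neg_injective ((hw g hg).symm.trans (e1.trans e2))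
    have i1 := integrable_mul Ω w g1.continuous g2
    have i2 : Integrable (fun x => evalAt x (pd i p) * g x) (volume.restrict (Ω : Set Pt)) :=
      (((continuous_evalAt _).mul g1.continuous).integrable_of_hasCompactSupport
        g2.mul_left).integrableOn
    calc ∫ x in (Ω : Set Pt), g x • (w x - evalAt x (pd i p))
        = ∫ x in (Ω : Set Pt), (w x * g x - evalAt x (pd i p) * g x) := by
          congr 1; funext x; simp only [smul_eq_mul]; ring
      _ = 0 := by rw [integral_sub i1 i2, e3, sub_self])
  have hnull : ∀ᵐ x ∂(volume.restrict (Ω : Set Pt)), x ∉ K.closedInterior \ K.interior :=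
    ae_restrict_of_ae (measure_eq_zero_iff_ae_notMem.1 (volume_closedInterior_diff_interior K))
  filter_upwards [key, hnull] with x hx hn hm
  exact sub_eq_zero.1 (hx (by_contra fun h => hn ⟨hm, h⟩))

theorem hasPiece_pieceL2_self (Ω : Opens Pt) (K : Tri) (p : Poly) :
    HasPiece Ω K (pieceL2 Ω K p) p := by
  have hnull : ∀ᵐ x ∂(volume.restrict (Ω : Set Pt)), x ∉ K.closedInterior \ K.interior :=
    ae_restrict_of_ae (measure_eq_zero_iff_ae_notMem.1 (volume_closedInterior_diff_interior K))
  filter_upwards [coeFn_pieceL2 Ω K p, hnull] with x hx hn hm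
  rw [hx, Set.indicator_of_mem (by_contra fun h => hn ⟨hm, h⟩)]

theorem HasPiece.setIntegral_eq {Ω : Opens Pt} {K : Tri} (hK : K.interior ⊆ (Ω : Set Pt))
    {v : L2 Ω} {p : Poly} (hp : HasPiece Ω K v p) :
    ∫ x in K.closedInterior, v x ∂(volume.restrict (Ω : Set Pt)) = integralTri K p := by
  have hm : MeasurableSet K.closedInterior := K.isClosed_closedInterior.measurableSet
  have h1 : ∫ x in K.closedInterior, v x ∂(volume.restrict (Ω : Set Pt)) =
      ∫ x in K.closedInterior, evalAt x p ∂(volume.restrict (Ω : Set Pt)) :=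
    setIntegral_congr_ae hm hp
  rw [h1, Measure.restrict_restrict hm]
  refine setIntegral_congr_set ?_
  refine (LE.le.eventuallyLE Set.inter_subset_left).antisymm ?_
  rw [ae_le_set]
  have hsub : K.closedInterior \ (K.closedInterior ∩ (Ω : Set Pt)) ⊆
      K.closedInterior \ K.interior := fun x hx => ⟨hx.1, fun h => hx.2 ⟨hx.1, hK h⟩⟩
  exact measure_mono_null hsub (volume_closedInterior_diff_interior K)

/-! ### Gluing pieces over the mesh. -/

/-- The function with pieces `p K`. -/
def glue (Ω : Opens Pt) (T : Finset Tri) (p : Tri → Poly) : L2 Ω := ∑ K ∈ T, pieceL2 Ω K (p K)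

section Mesh

variable {n : ℕ} {Ω : Opens Pt} {P : Polygon Pt n} {T : Finset Tri}

/-- Conformity makes overlaps null, so pieces on distinct elements do not interfere. -/
theorem IsMesh.volume_inter (hT : IsMesh Ω T) {K K' : Tri} (hK : K ∈ T) (hK' : K' ∈ T)
    (h : K ≠ K') : volume (K.closedInterior ∩ K'.closedInterior) = 0 := by
  rcases hT.conforming K hK K' hK' h with h | ⟨x, -, h⟩ | ⟨x, -, y, -, -, h⟩
  · rw [h, measure_empty]
  · rw [h, measure_singleton]
  · rw [h, volume_segment]

theorem IsMesh.hasPiece_pieceL2_of_ne (hT : IsMesh Ω T) {K K' : Tri} (hK : K ∈ T) (hK' : K' ∈ T)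
    (h : K ≠ K') (p : Poly) : HasPiece Ω K' (pieceL2 Ω K p) 0 := by
  have hnull : ∀ᵐ x ∂(volume.restrict (Ω : Set Pt)), x ∉ K.closedInterior ∩ K'.closedInterior :=
    ae_restrict_of_ae (measure_eq_zero_iff_ae_notMem.1 (hT.volume_inter hK hK' h))
  filter_upwards [coeFn_pieceL2 Ω K p, hnull] with x hx hn hm
  rw [hx, Set.indicator_of_notMem (fun h => hn ⟨K.interior_subset_closedInterior h, hm⟩), map_zero]

theorem hasPiece_sum {ι : Type*} (s : Finset ι) {K : Tri} {v : ι → L2 Ω} {p : ι → Poly}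
    (h : ∀ i ∈ s, HasPiece Ω K (v i) (p i)) : HasPiece Ω K (∑ i ∈ s, v i) (∑ i ∈ s, p i) := by
  classical
  induction s using Finset.induction_on with
  | empty => simpa using hasPiece_zero Ω K
  | insert i s hi ih =>
    rw [Finset.sum_insert hi, Finset.sum_insert hi]
    exact (h i (Finset.mem_insert_self i s)).add
      (ih fun j hj => h j (Finset.mem_insert_of_mem hj))

theorem IsMesh.hasPiece_glue (hT : IsMesh Ω T) (p : Tri → Poly) {K : Tri} (hK : K ∈ T) :
    HasPiece Ω K (glue Ω T p) (p K) := by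
  classical
  have h : HasPiece Ω K (glue Ω T p) (∑ K' ∈ T, if K' = K then p K' else 0) := by
    refine hasPiece_sum T fun K' hK' => ?_
    split_ifs with h
    · subst h
      exact hasPiece_pieceL2_self Ω K' _
    · exact hT.hasPiece_pieceL2_of_ne hK' hK h _
  rwa [Finset.sum_ite_eq' T K p, if_pos hK] at h

theorem IsMesh.ext (hT : IsMesh Ω T) {v w : L2 Ω} {p : Tri → Poly}
    (hv : ∀ K ∈ T, HasPiece Ω K v (p K)) (hw : ∀ K ∈ T, HasPiece Ω K w (p K)) : v = w := by
  refine Lp.ext ?_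
  have h1 : ∀ᵐ x ∂(volume.restrict (Ω : Set Pt)), ∀ K ∈ T, x ∈ K.closedInterior →
      v x = w x := by
    refine (ae_ball_iff (S := (T : Set Tri)) T.countable_toSet).2 fun K hK => ?_
    filter_upwards [hv K hK, hw K hK] with x hx hx' hm
    rw [hx hm, hx' hm]
  filter_upwards [h1, ae_restrict_mem Ω.isOpen.measurableSet] with x hx hm
  have := hT.cover.ge (subset_closure hm)
  simp only [Set.mem_iUnion] at this
  obtain ⟨K, hK, hmK⟩ := this
  exact hx K hK hmK

theorem IsMesh.finiteDimensional_piecewisePoly (hT : IsMesh Ω T) (d m : ℕ) :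
    FiniteDimensional ℝ (piecewisePoly Ω P T d m) := by
  let f : (T → degLT (d + 1)) →ₗ[ℝ] L2 Ω :=
    ∑ K : T, ((pieceL2 Ω K.1).comp (degLT (d + 1)).subtype).comp (LinearMap.proj K)
  have hle : piecewisePoly Ω P T d m ≤ LinearMap.range f := by
    rintro v ⟨p, hp, -⟩
    refine ⟨fun K => ⟨p K.1, mem_degLT_succ.2 (hp K.1 K.2).1⟩, ?_⟩
    have : v = glue Ω T p := hT.ext (fun K hK => (hp K hK).2) fun K hK => hT.hasPiece_glue p hK
    refine Eq.trans ?_ this.symm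
    rw [glue, ← Finset.sum_coe_sort]
    simp [f]
  exact Submodule.finiteDimensional_of_le hle

theorem IsMesh.wpartial_mem_piecewisePoly (hT : IsMesh Ω T) {d m : ℕ} {v : L2 Ω} (hv : v ∈ H1 Ω)
    (h : v ∈ piecewisePoly Ω P T d (m + 1)) (l : Fin 2) :
    wpartial l v ∈ piecewisePoly Ω P T (d - 1) m := by
  obtain ⟨p, hp, hj⟩ := h
  refine ⟨fun K => pd l (p K), fun K hK => ⟨totalDegree_pd_le l (hp K hK).1,
    (hp K hK).2.wpartial (hT.interior_subset K hK) (hasWeakPartial_wpartial hv l)⟩, ?_⟩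
  intro x hx K hK K' hK' hm hm' i j hij
  simp only [pd_zero_pow_pd_one_pow_pd]
  split_ifs
  · exact hj x hx K hK K' hK' hm hm' (i + 1) j (by omega)
  · exact hj x hx K hK K' hK' hm hm' i (j + 1) (by omega)

/-- Every piece has zero m-jet at its own vertices, so pieces sharing a vertex agree there. -/
theorem IsMesh.glue_mem_piecewisePoly (hT : IsMesh Ω T) {d m : ℕ} {p : Tri → Poly}
    (hd : ∀ K ∈ T, p K ∈ degLT (d + 1))
    (hp : ∀ K ∈ T, ∀ i, p K ∈ pointIdeal (K.points i) ^ (m + 1)) :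
    glue Ω T p ∈ piecewisePoly Ω P T d m := by
  refine ⟨p, fun K hK => ⟨mem_degLT_succ.1 (hd K hK), hT.hasPiece_glue p hK⟩, ?_⟩
  rintro x - K hK K' hK' ⟨l, rfl⟩ ⟨l', hl'⟩ i j hij
  rw [jet_eq_zero (hp K hK l) hij, ← hl', jet_eq_zero (hp K' hK' l') hij]

theorem exists_bubble_piece {K : Tri} (hK : K.interior ⊆ (Ω : Set Pt)) {v : L2 Ω} {p : Poly}
    (hp : HasPiece Ω K v p) (h : ZeroOnBoundary K v) : ∃ q, p = bubble K * q := by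
  obtain ⟨p', hp', h0⟩ := h
  obtain rfl := hp.unique hK hp'
  exact bubble_dvd K fun i t ht =>
    h0 _ _ (by fin_cases i <;> decide) _ (edgePt_mem_segment K i ht)

theorem zeroOnBoundary_of_bubble {K : Tri} {v : L2 Ω} {q : Poly}
    (h : HasPiece Ω K v (bubble K * q)) : ZeroOnBoundary K v :=
  ⟨_, h, fun i j hij x hx => by rw [evalAt_mul, evalAt_bubble_of_mem_segment K hij hx, zero_mul]⟩

theorem zeroNormalDerivOnBoundary_of_bubble_sq {K : Tri} {v : L2 Ω} {q : Poly}
    (h : HasPiece Ω K v (bubble K ^ 2 * q)) : ZeroNormalDerivOnBoundary K v :=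
  ⟨_, h, fun i j hij x hx ν _ => by
    simp [pd_bubble_sq_mul, evalAt_mul, evalAt_bubble_of_mem_segment K hij hx]⟩

theorem tangential_deriv_eq_zero {p : Poly} {A B : Pt}
    (h : ∀ x ∈ segment ℝ A B, evalAt x p = 0) (x : Pt) (hx : x ∈ segment ℝ A B) :
    ∑ l, (B - A) l * evalAt x (pd l p) = 0 := by
  rw [segment_eq_image'] at hx
  obtain ⟨t, -, rfl⟩ := hx
  have hz : ∀ t : ℝ, evalAt (A + t • (B - A)) p = 0 := evalAt_eq_zero_on_line fun t ht =>
    h _ (by rw [segment_eq_image']; exact ⟨t, ⟨ht.1.le, ht.2.le⟩, rfl⟩)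
  have h1 : HasDerivAt (fun t : ℝ => A + t • (B - A)) (B - A) t := by
    have := ((hasDerivAt_id t).smul_const (B - A)).const_add A
    rw [one_smul] at this
    exact this
  have h2 := (hasFDerivAt_evalAt p (A + t • (B - A))).comp_hasDerivAt t h1
  have h3 : HasDerivAt (fun t : ℝ => evalAt (A + t • (B - A)) p) 0 t := by
    simp only [hz]
    exact hasDerivAt_const t 0
  have h4 := h2.unique h3
  simpa [Fin.sum_univ_two, mul_comm] using h4

/-- A function that vanishes with its normal derivative on the boundary has zero gradient there. -/
theorem zeroOnBoundary_wpartial {K : Tri} (hK : K.interior ⊆ (Ω : Set Pt)) {v : L2 Ω}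
    (hv : v ∈ H1 Ω) (h : ZeroOnBoundary K v) (h' : ZeroNormalDerivOnBoundary K v) (l : Fin 2) :
    ZeroOnBoundary K (wpartial l v) := by
  obtain ⟨p, hp, h0⟩ := h
  obtain ⟨p', hp', h1⟩ := h'
  obtain rfl := hp.unique hK hp'
  refine ⟨pd l p, hp.wpartial hK (hasWeakPartial_wpartial hv l), fun i j hij x hx => ?_⟩
  have ht := tangential_deriv_eq_zero (h0 i j hij) x hx
  set d := K.points j - K.points i with hd
  -- The edge vector rotated by a right angle serves as normal. With the tangential equation it
  -- forms a system of determinant |d|² ≠ 0 for the gradient.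
  have hn := h1 i j hij x hx (!₂[-d 1, d 0]) (by
    rw [← hd, PiLp.inner_apply]
    simp [Fin.sum_univ_two]
    ring)
  simp only [Fin.sum_univ_two] at ht hn
  simp at hn
  have hd0 : d 0 ^ 2 + d 1 ^ 2 ≠ 0 := by
    intro h
    have a0 : d 0 = 0 := by nlinarith [sq_nonneg (d 0), sq_nonneg (d 1)]
    have a1 : d 1 = 0 := by nlinarith [sq_nonneg (d 0), sq_nonneg (d 1)]
    have : d = 0 := by ext m; fin_cases m <;> simp [a0, a1]
    exact hij (K.independent.injective (sub_eq_zero.1 this)).symm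
  have hx0 : (d 0 ^ 2 + d 1 ^ 2) * evalAt x (pd 0 p) = 0 := by linear_combination d 0 * ht - d 1 * hn
  have hx1 : (d 0 ^ 2 + d 1 ^ 2) * evalAt x (pd 1 p) = 0 := by linear_combination d 1 * ht + d 0 * hn
  fin_cases l
  · exact (mul_eq_zero.1 hx0).resolve_left hd0
  · exact (mul_eq_zero.1 hx1).resolve_left hd0

end Mesh

/-! ### The interior complex -/

section Complex

variable {n : ℕ} {Ω : Opens Pt} {P : Polygon Pt n} {T : Finset Tri} {k : ℕ}

theorem mem_L20_of_integral [IsFiniteMeasure (volume.restrict (Ω : Set Pt))] {q : L2 Ω}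
    (h : ∫ x in (Ω : Set Pt), q x = 0) : q ∈ L20 Ω :=
  ⟨(Lp.memLp q).integrable (by norm_num), h⟩

theorem wpartial_mem_L20 [IsFiniteMeasure (volume.restrict (Ω : Set Pt))] {v : L2 Ω}
    (hv : v ∈ H10 Ω) (i : Fin 2) : wpartial i v ∈ L20 Ω :=
  mem_L20_of_integral (integral_wpartial_eq_zero hv i)

theorem IsMesh.div_mem_Q0 [IsFiniteMeasure (volume.restrict (Ω : Set Pt))] (hT : IsMesh Ω T)
    {v : L2 Ω × L2 Ω} (hv : v ∈ V0 Ω P T k) : div v ∈ Q0 Ω P T k :=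
  ⟨add_mem (hT.wpartial_mem_piecewisePoly hv.1.1.1 hv.1.1.2 0)
      (hT.wpartial_mem_piecewisePoly hv.2.1.1 hv.2.1.2 1),
    add_mem (wpartial_mem_L20 hv.1.2 0) (wpartial_mem_L20 hv.2.2 1)⟩

theorem HasPiece.div {K : Tri} (hK : K.interior ⊆ (Ω : Set Pt)) {v : L2 Ω × L2 Ω} {p q : Poly}
    (hp : HasPiece Ω K v.1 p) (hq : HasPiece Ω K v.2 q) (hv : v ∈ (H1 Ω).prod (H1 Ω)) :
    HasPiece Ω K (div v) (pd 0 p + pd 1 q) :=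
  (hp.wpartial hK (hasWeakPartial_wpartial hv.1 0)).add
    (hq.wpartial hK (hasWeakPartial_wpartial hv.2 1))

/-- The pieces of functions that vanish on the boundaries of the elements. -/
theorem IsMesh.exists_bubble_pieces (hT : IsMesh Ω T) {d m : ℕ} {v : L2 Ω}
    (hv : v ∈ piecewisePoly Ω P T d m) (h : ∀ K ∈ T, ZeroOnBoundary K v) :
    ∃ q : Tri → Poly, ∀ K ∈ T, bubble K * q K ∈ degLT (d + 1) ∧
      HasPiece Ω K v (bubble K * q K) := by
  obtain ⟨p, hp, -⟩ := hv
  -- Stated for all triangles, with default 0 off the mesh, so that a total function can be chosen.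
  have hex : ∀ K, ∃ q, K ∈ T → p K = bubble K * q := by
    intro K
    by_cases hK : K ∈ T
    · obtain ⟨q, hq⟩ := exists_bubble_piece (hT.interior_subset K hK) (hp K hK).2 (h K hK)
      exact ⟨q, fun _ => hq⟩
    · exact ⟨0, fun h => absurd h hK⟩
  choose q hq using hex
  refine ⟨q, fun K hK => ?_⟩
  rw [← hq K hK]
  exact ⟨mem_degLT_succ.2 (hp K hK).1, (hp K hK).2⟩

theorem IsMesh.glue_bubble_mem [IsFiniteMeasure (volume.restrict (Ω : Set Pt))] (hT : IsMesh Ω T)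
    {q : Tri → Poly} (hq : ∀ K ∈ T, bubble K * q K ∈ degLT (k + 1)) :
    glue Ω T (fun K => bubble K * q K) ∈ V Ω P T k ⊓ H10 Ω := by
  have h10 : glue Ω T (fun K => bubble K * q K) ∈ H10 Ω :=
    sum_mem fun K hK => pieceL2_bubble_mem_H10 (hT.interior_subset K hK) (q K)
  exact ⟨⟨h10.1, hT.glue_mem_piecewisePoly hq fun K _ i => bubble_mul_mem_pointIdeal K i _⟩, h10⟩

theorem IsMesh.curl_mem_VI (hT : IsMesh Ω T) {ψ : L2 Ω} (hψ : ψ ∈ SigmaI Ω P T k) :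
    curl ψ ∈ VI Ω P T k := by
  have h1 : ψ ∈ H1 Ω := hψ.1.1.1.1
  have hV : ∀ l, wpartial l ψ ∈ V Ω P T k ⊓ H10 Ω := fun l =>
    have h10 := wpartial_mem_H10 hψ.1.1 l
    ⟨⟨h10.1, hT.wpartial_mem_piecewisePoly h1 hψ.1.2 l⟩, h10⟩
  have hz : ∀ l, ∀ K ∈ T, ZeroOnBoundary K (wpartial l ψ) := fun l K hK =>
    zeroOnBoundary_wpartial (hT.interior_subset K hK) h1 (hψ.2 K hK).1 (hψ.2 K hK).2 l
  refine ⟨⟨hV 1, neg_mem (hV 0)⟩, fun K hK => ⟨hz 1 K hK, ?_⟩⟩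
  obtain ⟨p, hp, h0⟩ := hz 0 K hK
  refine ⟨(-1 : ℝ) • p, ?_, fun i j hij x hx => by rw [map_smul, h0 i j hij x hx, smul_zero]⟩
  have := hp.smul (-1)
  rwa [neg_one_smul] at this

/-- The pieces are multiples of b, which vanishes to second order at the vertices, so their
derivatives vanish there. The means vanish by `integralTri_pd_bubble`. -/
theorem IsMesh.div_mem_QI [IsFiniteMeasure (volume.restrict (Ω : Set Pt))] (hT : IsMesh Ω T)
    {v : L2 Ω × L2 Ω} (hv : v ∈ VI Ω P T k) : div v ∈ QI Ω P T k := by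
  refine ⟨hT.div_mem_Q0 hv.1, fun K hK => ?_⟩
  have hKΩ := hT.interior_subset K hK
  obtain ⟨a, ha⟩ := hT.exists_bubble_pieces hv.1.1.1.2 fun K hK => (hv.2 K hK).1
  obtain ⟨b, hb⟩ := hT.exists_bubble_pieces hv.1.2.1.2 fun K hK => (hv.2 K hK).2
  have hp : HasPiece Ω K (div v) (pd 0 (bubble K * a K) + pd 1 (bubble K * b K)) :=
    (ha K hK).2.div hKΩ (hb K hK).2 (V0_le Ω P T k hv.1)
  refine ⟨?_, _, hp, fun i => ?_⟩
  · rw [hp.setIntegral_eq hKΩ, map_add, integralTri_pd_bubble, integralTri_pd_bubble, add_zero]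
  · rw [map_add, evalAt_pd_of_mem_pointIdeal (bubble_mul_mem_pointIdeal K i _),
      evalAt_pd_of_mem_pointIdeal (bubble_mul_mem_pointIdeal K i _), add_zero]

/-- The equation is solved on each triangle by `exists_divBubble_eq`; bubble fields glue freely. -/
theorem IsMesh.exists_div_eq [IsFiniteMeasure (volume.restrict (Ω : Set Pt))] (hT : IsMesh Ω T)
    (hk : 1 ≤ k) {q : L2 Ω} (hq : q ∈ QI Ω P T k) : ∃ v ∈ VI Ω P T k, div v = q := by
  obtain ⟨⟨⟨p, hp, -⟩, -⟩, hI⟩ := hq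
  have hex : ∀ K, ∃ ab : Poly × Poly, K ∈ T → bubble K * ab.1 ∈ degLT (k + 1) ∧
      bubble K * ab.2 ∈ degLT (k + 1) ∧
      pd 0 (bubble K * ab.1) + pd 1 (bubble K * ab.2) = p K := by
    intro K
    by_cases hK : K ∈ T
    · obtain ⟨h1, p', hp', h2⟩ := hI K hK
      have hKΩ := hT.interior_subset K hK
      obtain rfl := hp'.unique hKΩ (hp K hK).2
      rw [(hp K hK).2.setIntegral_eq hKΩ] at h1
      have hd : p K ∈ degLT k := by
        have := mem_degLT_succ.2 (hp K hK).1
        rwa [Nat.sub_add_cancel hk] at this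
      obtain ⟨a, b, h⟩ := exists_divBubble_eq K (integralTri K)
        (integralTri_bary_mul_bary_ne_zero K) (integralTri_pd_bubble K) hd h2 h1
      exact ⟨(a, b), fun _ => h⟩
    · exact ⟨0, fun h => absurd h hK⟩
  choose ab hab using hex
  let a : Tri → Poly := fun K => (ab K).1
  let b : Tri → Poly := fun K => (ab K).2
  have m1 : glue Ω T (fun K => bubble K * a K) ∈ V Ω P T k ⊓ H10 Ω :=
    hT.glue_bubble_mem fun K hK => (hab K hK).1
  have m2 : glue Ω T (fun K => bubble K * b K) ∈ V Ω P T k ⊓ H10 Ω :=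
    hT.glue_bubble_mem fun K hK => (hab K hK).2.1
  have p1 : ∀ K ∈ T, HasPiece Ω K (glue Ω T fun K => bubble K * a K) (bubble K * a K) :=
    fun K hK => hT.hasPiece_glue (fun K => bubble K * a K) hK
  have p2 : ∀ K ∈ T, HasPiece Ω K (glue Ω T fun K => bubble K * b K) (bubble K * b K) :=
    fun K hK => hT.hasPiece_glue (fun K => bubble K * b K) hK
  refine ⟨(glue Ω T fun K => bubble K * a K, glue Ω T fun K => bubble K * b K),
    ⟨⟨m1, m2⟩, fun K hK => ⟨zeroOnBoundary_of_bubble (p1 K hK),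
      zeroOnBoundary_of_bubble (p2 K hK)⟩⟩, ?_⟩
  refine hT.ext (p := p) (fun K hK => ?_) fun K hK => (hp K hK).2
  rw [← (hab K hK).2.2]
  exact HasPiece.div (hT.interior_subset K hK) (p1 K hK) (p2 K hK) ⟨m1.1.1, m2.1.1⟩

/-- Stream functions b²r are found element by element and glued. They are in H²₀ and have zero
2-jets at the vertices. -/
theorem IsMesh.exists_curl_eq [IsFiniteMeasure (volume.restrict (Ω : Set Pt))] (hT : IsMesh Ω T)
    {v : L2 Ω × L2 Ω} (hv : v ∈ VI Ω P T k) (hdiv : div v = 0) :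
    ∃ ψ ∈ SigmaI Ω P T k, curl ψ = v := by
  obtain ⟨a, ha⟩ := hT.exists_bubble_pieces hv.1.1.1.2 fun K hK => (hv.2 K hK).1
  obtain ⟨b, hb⟩ := hT.exists_bubble_pieces hv.1.2.1.2 fun K hK => (hv.2 K hK).2
  have hex : ∀ K, ∃ r, K ∈ T → bubble K ^ 2 * r ∈ degLT (k + 1 + 1) ∧
      pd 1 (bubble K ^ 2 * r) = bubble K * a K ∧
      pd 0 (bubble K ^ 2 * r) = -(bubble K * b K) := by
    intro K
    by_cases hK : K ∈ T
    · have hKΩ := hT.interior_subset K hK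
      have hp : HasPiece Ω K (div v) (pd 0 (bubble K * a K) + pd 1 (bubble K * b K)) :=
        (ha K hK).2.div hKΩ (hb K hK).2 (V0_le Ω P T k hv.1)
      rw [hdiv] at hp
      obtain ⟨r, hr⟩ := exists_stream_bubble K (ha K hK).1 (hb K hK).1
        (hp.unique hKΩ (hasPiece_zero Ω K))
      exact ⟨r, fun _ => hr⟩
    · exact ⟨0, fun h => absurd h hK⟩
  choose r hr using hex
  have h20 : glue Ω T (fun K => bubble K ^ 2 * r K) ∈ H20 Ω :=
    sum_mem fun K hK => pieceL2_bubble_sq_mem_H20 (hT.interior_subset K hK) (r K)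
  have hpc : ∀ K ∈ T, HasPiece Ω K (glue Ω T fun K => bubble K ^ 2 * r K) (bubble K ^ 2 * r K) :=
    fun K hK => hT.hasPiece_glue _ hK
  refine ⟨glue Ω T fun K => bubble K ^ 2 * r K, ⟨⟨h20, ?_⟩, fun K hK => ⟨?_, ?_⟩⟩, ?_⟩
  · exact hT.glue_mem_piecewisePoly (fun K hK => (hr K hK).1) fun K _ i =>
      Ideal.pow_le_pow_right (by norm_num) (bubble_sq_mul_mem_pointIdeal K i (r K))
  · refine zeroOnBoundary_of_bubble (q := bubble K * r K) ?_
    rw [← mul_assoc, ← sq]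
    exact hpc K hK
  · exact zeroNormalDerivOnBoundary_of_bubble_sq (hpc K hK)
  · refine Prod.ext ?_ ?_
    · refine hT.ext (p := fun K => bubble K * a K) (fun K hK => ?_) fun K hK => (ha K hK).2
      rw [← (hr K hK).2.1]
      exact (hpc K hK).wpartial (hT.interior_subset K hK) (hasWeakPartial_wpartial h20.1.1 1)
    · refine hT.ext (p := fun K => bubble K * b K) (fun K hK => ?_) fun K hK => (hb K hK).2
      have h := ((hpc K hK).wpartial (hT.interior_subset K hK)
        (hasWeakPartial_wpartial h20.1.1 0)).smul (-1)
      rwa [(hr K hK).2.2, neg_one_smul, neg_one_smul, neg_neg] at h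

/-! ### Definiteness -/

/-- Each piece is constant and vanishes at a vertex of its triangle. -/
theorem IsMesh.eq_zero_of_wpartial_eq_zero (hT : IsMesh Ω T) {d m : ℕ} {v : L2 Ω}
    (hv : v ∈ piecewisePoly Ω P T d m) (hH : v ∈ H1 Ω) (hb : ∀ K ∈ T, ZeroOnBoundary K v)
    (h : ∀ i, wpartial i v = 0) : v = 0 := by
  obtain ⟨q, hq⟩ := hT.exists_bubble_pieces hv hb
  refine hT.ext (p := fun _ => 0) (fun K hK => ?_) fun K _ => hasPiece_zero Ω K
  have hKΩ := hT.interior_subset K hK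
  obtain ⟨c, hc⟩ := eq_C_of_pd_eq_zero (p := bubble K * q K) fun i => by
    have := (hq K hK).2.wpartial hKΩ (hasWeakPartial_wpartial hH i)
    rw [h i] at this
    exact this.unique hKΩ (hasPiece_zero Ω K)
  have h0 : evalAt (K.points 0) (bubble K * q K) = 0 := by
    rw [evalAt_mul, evalAt_bubble_of_mem_segment K (i := 0) (j := 1) (by decide)
      (left_mem_segment ℝ _ _), zero_mul]
  rw [hc, evalAt_C] at h0
  have hp := (hq K hK).2
  rwa [hc, h0, map_zero] at hp

theorem a_comm (u v : L2 Ω × L2 Ω) : a u v = a v u := by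
  simp only [a, real_inner_comm]

theorem wpartial_eq_zero_of_a_self {v : L2 Ω × L2 Ω} (h : a v v = 0) (j : Fin 2) :
    wpartial j v.1 = 0 ∧ wpartial j v.2 = 0 := by
  have h1 := (Finset.sum_eq_zero_iff_of_nonneg fun j _ =>
    add_nonneg real_inner_self_nonneg real_inner_self_nonneg).1 h j (Finset.mem_univ j)
  have h2 := (add_eq_zero_iff_of_nonneg real_inner_self_nonneg real_inner_self_nonneg).1 h1
  exact ⟨inner_self_eq_zero.1 h2.1, inner_self_eq_zero.1 h2.2⟩

theorem IsMesh.eq_zero_of_a_self (hT : IsMesh Ω T) {v : L2 Ω × L2 Ω} (hv : v ∈ VI Ω P T k)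
    (h : a v v = 0) : v = 0 :=
  Prod.ext
    (hT.eq_zero_of_wpartial_eq_zero hv.1.1.1.2 hv.1.1.1.1 (fun K hK => (hv.2 K hK).1)
      fun j => (wpartial_eq_zero_of_a_self h j).1)
    (hT.eq_zero_of_wpartial_eq_zero hv.1.2.1.2 hv.1.2.1.1 (fun K hK => (hv.2 K hK).2)
      fun j => (wpartial_eq_zero_of_a_self h j).2)

theorem IsMesh.eq_zero_of_curl_eq_zero (hT : IsMesh Ω T) {ψ : L2 Ω} (hψ : ψ ∈ SigmaI Ω P T k)
    (h : curl ψ = 0) : ψ = 0 := by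
  refine hT.eq_zero_of_wpartial_eq_zero hψ.1.2 hψ.1.1.1.1 (fun K hK => (hψ.2 K hK).1) fun i => ?_
  fin_cases i
  · exact neg_eq_zero.1 (congrArg Prod.snd h)
  · exact congrArg Prod.fst h

/-- The projection onto `curl Σ_I` for the form `a`. -/
theorem IsMesh.exists_curl_projection (hT : IsMesh Ω T) (u : L2 Ω × L2 Ω) :
    ∃ ψ ∈ SigmaI Ω P T k, ∀ χ ∈ SigmaI Ω P T k, a (curl ψ) (curl χ) = a u (curl χ) := by
  have hfd : FiniteDimensional ℝ (SigmaI Ω P T k) :=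
    have := hT.finiteDimensional_piecewisePoly (P := P) (k + 1) 2
    Submodule.finiteDimensional_of_le (S₂ := piecewisePoly Ω P T (k + 1) 2) fun ψ hψ => hψ.1.2
  have hadd : ∀ (w : L2 Ω × L2 Ω) (x y : SigmaI Ω P T k),
      a w (curl (x + y : L2 Ω)) = a w (curl x.1) + a w (curl y.1) := fun w x y => by
    rw [curl_add x.2.1.1.1.1 y.2.1.1.1.1, a_comm, a_add_left (curl_mem x.2.1.1.1)
      (curl_mem y.2.1.1.1), a_comm w, a_comm w]
  have hsmul : ∀ (w : L2 Ω × L2 Ω) (c : ℝ) (x : SigmaI Ω P T k),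
      a w (curl (c • x : L2 Ω)) = c * a w (curl x.1) := fun w c x => by
    rw [curl_smul c x.2.1.1.1.1, a_comm, a_smul_left c (curl_mem x.2.1.1.1), a_comm w]
  -- Additivity of `wpartial` is available on `H1` only, as it defaults to 0 where no weak
  -- derivative exists. The functionals are therefore built on `SigmaI`.
  let f : (L2 Ω × L2 Ω) → SigmaI Ω P T k →ₗ[ℝ] ℝ := fun w =>
    { toFun := fun x => a w (curl x.1)
      map_add' := hadd w
      map_smul' := hsmul w }
  let B : SigmaI Ω P T k →ₗ[ℝ] Module.Dual ℝ (SigmaI Ω P T k) :=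
    { toFun := fun x => f (curl x.1)
      map_add' := fun x y => LinearMap.ext fun z => by
        change a (curl (x + y : L2 Ω)) _ = a (curl x.1) _ + a (curl y.1) _
        rw [a_comm, hadd, a_comm, a_comm (curl z.1)]
      map_smul' := fun c x => LinearMap.ext fun z => by
        change a (curl (c • x : L2 Ω)) _ = c * a (curl x.1) _
        rw [a_comm, hsmul, a_comm] }
  -- Definiteness gives injectivity into the dual, and finite dimension turns this into
  -- surjectivity, so the functional of `u` is represented.
  have hinj : Function.Injective B := by
    rw [injective_iff_map_eq_zero]
    intro x hx
    have h0 : a (curl x.1) (curl x.1) = 0 := LinearMap.congr_fun hx x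
    exact Subtype.ext (hT.eq_zero_of_curl_eq_zero x.2
      (hT.eq_zero_of_a_self (hT.curl_mem_VI x.2) h0))
  have hsurj : Function.Surjective B :=
    (LinearMap.injective_iff_surjective_of_finrank_eq_finrank
      Subspace.dual_finrank_eq.symm).1 hinj
  obtain ⟨ψ, hψ⟩ := hsurj (f u)
  exact ⟨ψ.1, ψ.2, fun χ hχ => LinearMap.congr_fun hψ ⟨χ, hχ⟩⟩

/-! ### The decompositions -/

theorem IsMesh.isDirectSum_Sigma0 (hT : IsMesh Ω T) :
    IsDirectSum (Sigma0 Ω P T k) (SigmaI Ω P T k) (SigmaE Ω P T k) := by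
  refine ⟨le_antisymm (fun φ hφ => ?_) (sup_le (fun φ hφ => hφ.1) fun φ hφ => hφ.1), ?_⟩
  · obtain ⟨ψ, hψ, h⟩ := hT.exists_curl_projection (P := P) (k := k) (curl φ)
    have hsub : φ - ψ ∈ Sigma0 Ω P T k := sub_mem hφ hψ.1
    refine Submodule.mem_sup.2 ⟨ψ, hψ, φ - ψ, ⟨hsub, fun χ hχ => ?_⟩, add_sub_cancel _ _⟩
    have e : curl φ = curl ψ + curl (φ - ψ) := by
      rw [← curl_add hψ.1.1.1.1 hsub.1.1.1, add_sub_cancel]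
    have h1 := h χ hχ
    rw [e, a_add_left (curl_mem hψ.1.1.1) (curl_mem hsub.1.1)] at h1
    linarith
  · rw [eq_bot_iff]
    rintro ψ ⟨hI, hE⟩
    exact hT.eq_zero_of_curl_eq_zero hI (hT.eq_zero_of_a_self (hT.curl_mem_VI hI) (hE.2 ψ hI))

theorem IsMesh.isDirectSum_Q0 (hT : IsMesh Ω T) :
    IsDirectSum (Q0 Ω P T k) (QI Ω P T k) (QE Ω P T k) := by
  refine ⟨le_antisymm (fun q hq => ?_) (sup_le (fun q hq => hq.1) fun q hq => hq.1), ?_⟩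
  · have hfd : FiniteDimensional ℝ (QI Ω P T k) :=
      have := hT.finiteDimensional_piecewisePoly (P := P) (k - 1) 0
      Submodule.finiteDimensional_of_le (S₂ := piecewisePoly Ω P T (k - 1) 0) fun q hq => hq.1.1
    obtain ⟨y, hy, z, hz, rfl⟩ := (QI Ω P T k).exists_add_mem_mem_orthogonal q
    refine Submodule.mem_sup.2 ⟨y, hy, z, ⟨?_, fun r hr => ?_⟩, rfl⟩
    · have := sub_mem hq hy.1
      rwa [add_sub_cancel_left] at this
    · rw [real_inner_comm]
      exact hz r hr
  · rw [eq_bot_iff]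
    rintro q ⟨hI, hE⟩
    exact inner_self_eq_zero.1 (hE.2 q hI)

/-- The interior part is w + curl ψ: w carries the Q_I part of the divergence, and curl ψ is the
a-projection of v - w onto curl Σ_I, which does not change the divergence. -/
theorem IsMesh.isDirectSum_V0 [IsFiniteMeasure (volume.restrict (Ω : Set Pt))] (hT : IsMesh Ω T)
    (hk : 1 ≤ k) : IsDirectSum (V0 Ω P T k) (VI Ω P T k) (VE Ω P T k) := by
  refine ⟨le_antisymm (fun v hv => ?_) (sup_le (fun v hv => hv.1) fun v hv => hv.1), ?_⟩
  · have hdv := hT.div_mem_Q0 hv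
    rw [hT.isDirectSum_Q0.1] at hdv
    obtain ⟨r, hr, e, he, hre⟩ := Submodule.mem_sup.1 hdv
    obtain ⟨w, hw, hwr⟩ := hT.exists_div_eq hk hr
    have hvw : v - w ∈ V0 Ω P T k := sub_mem hv hw.1
    obtain ⟨ψ, hψ, hproj⟩ := hT.exists_curl_projection (P := P) (k := k) (v - w)
    have hcψ := hT.curl_mem_VI hψ
    have hu : v - w - curl ψ ∈ V0 Ω P T k := sub_mem hvw hcψ.1
    -- Checked on the pieces, where mixed derivatives of polynomials commute.
    have hcdiv : div (curl ψ) = 0 := by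
      obtain ⟨p, hp, -⟩ := hψ.1.2
      have hH := hψ.1.1.1
      refine hT.ext (p := fun _ => 0) (fun K hK => ?_) fun K _ => hasPiece_zero Ω K
      have hKΩ := hT.interior_subset K hK
      have h1 := fun l => (hp K hK).2.wpartial hKΩ (hasWeakPartial_wpartial hH.1 l)
      have h2 := (h1 1).wpartial hKΩ (hasWeakPartial_wpartial (hH.2 1) 0)
      have h3 := (((h1 0).wpartial hKΩ (hasWeakPartial_wpartial (hH.2 0) 1)).smul (-1))
      have h4 := h2.add h3
      rw [pd_comm 0 1, neg_one_smul, neg_one_smul, add_neg_cancel] at h4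
      have e : div (curl ψ) = wpartial 0 (wpartial 1 ψ) + -wpartial 1 (wpartial 0 ψ) := by
        have := wpartial_smul 1 (-1) (hH.2 0)
        rw [neg_one_smul, neg_one_smul] at this
        rw [div, curl, this]
      rwa [e]
    have e1 : v = w + (curl ψ + (v - w - curl ψ)) := by abel
    have hd : div v = div w + (div (curl ψ) + div (v - w - curl ψ)) := by
      conv_lhs => rw [e1]
      rw [div_add (V0_le Ω P T k hw.1) (V0_le Ω P T k (add_mem hcψ.1 hu)),
        div_add (V0_le Ω P T k hcψ.1) (V0_le Ω P T k hu)]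
    have hde : div (v - w - curl ψ) = e := by
      rw [hwr, hcdiv, zero_add, ← hre] at hd
      exact (add_left_cancel hd).symm
    refine Submodule.mem_sup.2 ⟨w + curl ψ, add_mem hw hcψ, v - w - curl ψ,
      ⟨hu, hde ▸ he, fun χ hχ => ?_⟩, by abel⟩
    have h1 := hproj χ hχ
    have e2 : v - w = curl ψ + (v - w - curl ψ) := by abel
    rw [e2, a_add_left (V0_le Ω P T k hcψ.1) (V0_le Ω P T k hu)] at h1
    linarith
  · rw [eq_bot_iff]
    rintro v ⟨hI, hE⟩
    -- The divergence lies in both Q_I and its orthogonal complement, so it can be tested against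
    -- itself.
    have hdiv : div v = 0 := inner_self_eq_zero.1 (hE.2.1.2 _ (hT.div_mem_QI hI))
    obtain ⟨ψ, hψ, rfl⟩ := hT.exists_curl_eq hI hdiv
    exact hT.eq_zero_of_a_self hI (hE.2.2 ψ hψ)

end Complex

end StokesFE
end

theorem mainTheorem7 {n : ℕ} [NeZero n] (Ω : TopologicalSpace.Opens StokesFE.Pt)
    (P : Polygon StokesFE.Pt n) (hΩ : StokesFE.IsPolygonalDomain Ω P)
    (T : Finset StokesFE.Tri) (hT : StokesFE.IsMesh Ω T) (k : ℕ) (hk : 1 ≤ k) :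
    StokesFE.IsDirectSum (StokesFE.Sigma0 Ω P T k) (StokesFE.SigmaI Ω P T k)
      (StokesFE.SigmaE Ω P T k) ∧
    StokesFE.IsDirectSum (StokesFE.V0 Ω P T k) (StokesFE.VI Ω P T k)
      (StokesFE.VE Ω P T k) ∧
    StokesFE.IsDirectSum (StokesFE.Q0 Ω P T k) (StokesFE.QI Ω P T k)
      (StokesFE.QE Ω P T k) := by
  -- Boundedness of Ω puts constants in L² and supplies the dominating functions for the limits.
  have hfin : IsFiniteMeasure (volume.restrict (Ω : Set StokesFE.Pt)) :=
    ⟨by rw [Measure.restrict_apply_univ]; exact hΩ.bounded.measure_lt_top⟩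
  exact ⟨hT.isDirectSum_Sigma0, hT.isDirectSum_V0 hk, hT.isDirectSum_Q0⟩
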